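/- **Model.** For subjects $i=1,2,\dots$ let $Z_i\in\mathbb R^r$ be observed covariates and let $$\eta_i=\alpha+B\varphi(\xi_i)+\Gamma Z_i+\zeta_i,\qquad \xi_i=\tilde\alpha+\tilde B\xi_i+\tilde\Gamma Z_i+\tilde\zeta_i,$$ $$Y_i=\nu+\Lambda\eta_i+KZ_i+\epsilon_i,\qquad X_i=\tilde\nu+\tilde\Lambda\xi_i+\tilde KZ_i+\tilde\epsilon_i,$$ where $\eta_i\in\mathbb R^p$, $\xi_i\in\mathbb R^q$ are latent, $Y_i\in\mathbb R^m$, $X_i\in\mathbb R^h$ are observed, $\varphi:\mathbb R^q\to\mathbb R^l$ is measurable, $\varphi(\xi_i)$ and $Z_i$ have finite second moments, and the vectors $(Z_i,\zeta_i,\tilde\zeta_i,\epsilon_i,\tilde\epsilon_i)$ are i.i.d. over $i$ with mutually independent components. The residuals $\zeta_i,\tilde\zeta_i,\epsilon_i,\tilde\epsilon_i$ have mean $0$ and covariance matrices $\Psi,\tilde\Psi,\Omega,\tilde\Omega$. The laws of $\tilde\zeta_i$ and $\tilde\epsilon_i$ belong to specified families of centred laws $L_{\tilde\Psi}$, $E_{\tilde\Omega}$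 indexed by their covariance matrices (for example normal laws). Put $\theta_1=(\tilde\alpha,\tilde B,\tilde\Gamma,\tilde\nu,\tilde\Lambda,\tilde K,\tilde\Omega,\tilde\Psi)$ and $\theta_2=(\kappa,\Psi)$ with $\kappa=(\alpha,B,\Gamma,\nu,\Lambda,K,\Omega)$; denote by $\theta_1^0$, $\theta_2^0=(\kappa^0,\Psi^0)$ the true values. **Parameter sets.** $\theta_1$ ranges over a compact set $\Theta_1\ni\theta_1^0$ on which $\tilde B$ has zero diagonal and $I-\tilde B$ is invertible, and $\theta_2$ over $\Theta_2=\{(\kappa,\Psi):\kappa\in C,\ \Psi\succeq0\}$ ($\Psi$ unrestricted), where $C\ni\kappa^0$ is compact and on $C$ the matrix $\Omega$ is positive semidefinite and $\Lambda$ has full column rank (as it does when each latent outcome has a pure reference indicator). The matrix $\Lambda\Psi\Lambda^t+\Omega$ is positive definite at $\theta_2^0$. **Estimator (2SSEM).** Let $p_{\theta_1}(x\mid z)$ be the Lebesgue density of $X$ given $Z=z$ and $\varphi^*_{\theta_1}(x,z)=E_{\theta_1}[\varphi(\xi)\mid X=x,Z=z]$ the conditional mean in the model with parameter $\theta_1\in\Theta_1$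 (where $\varphi(\xi)$ is assumed integrable). 1. $\hat\theta_1=\hat\theta_{1,n}$ maximises $\prod_{i=1}^n p_{\theta_1}(X_i\mid Z_i)$ over $\Theta_1$. 2. $\hat\theta_2=\hat\theta_{2,n}=(\hat\kappa,\hat\Psi)$ maximises over $\Theta_2$ the normal likelihood of the linear SEM for $Y_i$ in which $\varphi(\xi_i)$ is replaced by the covariate $f_i=\varphi^*_{\hat\theta_1}(X_i,Z_i)$, that is, of $Y_i\sim N\big(\nu+\Lambda(\alpha+Bf_i+\Gamma Z_i)+KZ_i,\ \Lambda\Psi\Lambda^t+\Omega\big)$, $i=1,\dots,n$, among the parameters for which $\Lambda\Psi\Lambda^t+\Omega$ is positive definite. Almost surely, such maximisers are used for all large $n$. **Regularity and identification.** For almost every value $(x,z)$ of $(X,Z)$ under the true distribution, $p_{\theta_1}(x\mid z)$ and $\varphi^*_{\theta_1}(x,z)$ are continuous in $\theta_1\in\Theta_1$; $\log\{p_{\theta_1}(X\mid Z)/p_{\theta_1^0}(X\mid Z)\}$ is bounded above, uniformly in $\theta_1\in\Theta_1$, by an integrable function of $(X,Z)$; in a neighbourhood of $\theta_1^0$ in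 $\Theta_1$, $\|\varphi^*_{\theta_1}(X,Z)\|$ is bounded by a square integrable function of $(X,Z)$. No $\theta_1\in\Theta_1$ other than $\theta^0_1$ gives the same law of $(Z,X)$. With $\varphi^*=E[\varphi(\xi)\mid X,Z]$ under the true distribution, at most one $\theta_2\in\Theta_2$ is such that the step-2 linear SEM, with covariates $(Z,\varphi^*)$ having their true moments, reproduces the true mean and covariance matrix of $(Z,\varphi^*,Y)$. **Theorem.** Under these assumptions, as $n\to\infty$, almost surely $$\hat\theta_1\to\theta_1^0,\qquad (\hat\alpha,\hat B,\hat\Gamma,\hat\nu,\hat\Lambda,\hat K,\hat\Omega)\to(\alpha,B,\Gamma,\nu,\Lambda,K,\Omega),\qquad \hat\Psi\to\Psi+B\,\mathrm{Var}\big[\varphi(\xi)-E(\varphi(\xi)\mid X,Z)\big]B^t,$$ the right-hand sides being the true values. Thus 2SSEM is consistent for all parameters except the residual covariance $\Psi$ of the latent outcome. -/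

import Mathlib

open MeasureTheory ProbabilityTheory Filter Topology
open scoped Matrix NNReal

noncomputable section

namespace TwoStageSEM

/-! ### Parameters -/

/-- Parameters of the linear SEM for `X` given `Z`:
`ξ = alpha + B ξ + Gamma Z + ζ'`, `X = nu + Lambda ξ + K Z + ε'`,
with `Psi`, `Omega` the covariance matrices of `ζ'`, `ε'`. -/
@[ext]
structure StepOneParam (q r h : ℕ) where
  alpha : Fin q → ℝ
  B : Matrix (Fin q) (Fin q) ℝ
  Gamma : Matrix (Fin q) (Fin r) ℝ
  nu : Fin h → ℝ
  Lambda : Matrix (Fin h) (Fin q) ℝ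
  K : Matrix (Fin h) (Fin r) ℝ
  Omega : Matrix (Fin h) (Fin h) ℝ
  Psi : Matrix (Fin q) (Fin q) ℝ

/-- The parameters of the outcome part, apart from the covariance matrix of `ζ`:
`η = alpha + B φ(ξ) + Gamma Z + ζ`, `Y = nu + Lambda η + K Z + ε`, with `Omega` the covariance
matrix of `ε`. -/
@[ext]
structure StepTwoCore (p r l m : ℕ) where
  alpha : Fin p → ℝ
  B : Matrix (Fin p) (Fin l) ℝ
  Gamma : Matrix (Fin p) (Fin r) ℝ
  nu : Fin m → ℝ
  Lambda : Matrix (Fin m) (Fin p) ℝ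
  K : Matrix (Fin m) (Fin r) ℝ
  Omega : Matrix (Fin m) (Fin m) ℝ

/-- All parameters of the outcome part; `Psi` is the covariance matrix of `ζ`. -/
@[ext]
structure StepTwoParam (p r l m : ℕ) extends StepTwoCore p r l m where
  Psi : Matrix (Fin p) (Fin p) ℝ

variable {p q r l h m : ℕ}

/-- The parameter as a point of a Euclidean space. -/
def StepOneParam.toProd (θ : StepOneParam q r h) :
    (Fin q → ℝ) × Matrix (Fin q) (Fin q) ℝ × Matrix (Fin q) (Fin r) ℝ × (Fin h → ℝ) ×
      Matrix (Fin h) (Fin q) ℝ × Matrix (Fin h) (Fin r) ℝ × Matrix (Fin h) (Fin h) ℝ ×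
      Matrix (Fin q) (Fin q) ℝ :=
  (θ.alpha, θ.B, θ.Gamma, θ.nu, θ.Lambda, θ.K, θ.Omega, θ.Psi)

/-- The parameter as a point of a Euclidean space. -/
def StepTwoCore.toProd (κ : StepTwoCore p r l m) :
    (Fin p → ℝ) × Matrix (Fin p) (Fin l) ℝ × Matrix (Fin p) (Fin r) ℝ × (Fin m → ℝ) ×
      Matrix (Fin m) (Fin p) ℝ × Matrix (Fin m) (Fin r) ℝ × Matrix (Fin m) (Fin m) ℝ :=
  (κ.alpha, κ.B, κ.Gamma, κ.nu, κ.Lambda, κ.K, κ.Omega)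

/-- Parameters carry the Euclidean topology (convergence of every entry). -/
instance : TopologicalSpace (StepOneParam q r h) := .induced StepOneParam.toProd inferInstance

/-- Parameters carry the Euclidean topology (convergence of every entry). -/
instance : TopologicalSpace (StepTwoCore p r l m) := .induced StepTwoCore.toProd inferInstance

/-! ### Moments -/

/-- `μ` is a probability law with finite second moments, mean zero and covariance matrix `C`. -/
structure IsResidualLaw {d : ℕ} (μ : Measure (Fin d → ℝ)) (C : Matrix (Fin d) (Fin d) ℝ) :
    Prop where
  isProbabilityMeasure : IsProbabilityMeasure μ
  memLp : MemLp id 2 μ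
  mean_eq_zero : ∀ i, ∫ x, x i ∂μ = 0
  covariance_eq : ∀ i j, ∫ x, x i * x j ∂μ = C i j

/-- The matrix `Cov(f, g)` of two random vectors. -/
def crossCov {S : Type*} [MeasurableSpace S] (P : Measure S) {a b : ℕ}
    (f : S → Fin a → ℝ) (g : S → Fin b → ℝ) : Matrix (Fin a) (Fin b) ℝ :=
  Matrix.of fun i j => cov[fun ω => f ω i, fun ω => g ω j; P]

/-! ### The step-one model

A residual specification consists of two families of laws, `L Psi` for the residual of the latent
predictor and `E Omega` for the measurement error, indexed by the covariance matrix. The triples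
`w = (z, ζ', ε')` are the exogenous variables of the step-one model. -/

/-- The latent predictor, i.e. the solution `ξ` of `ξ = alpha + B ξ + Gamma z + ζ'`. -/
def StepOneParam.latent (θ : StepOneParam q r h)
    (w : (Fin r → ℝ) × (Fin q → ℝ) × (Fin h → ℝ)) : Fin q → ℝ :=
  (1 - θ.B)⁻¹ *ᵥ (θ.alpha + θ.Gamma *ᵥ w.1 + w.2.1)

/-- The observed pair `(z, x)` with `x = nu + Lambda ξ + K z + ε'`. -/
def StepOneParam.obs (θ : StepOneParam q r h)
    (w : (Fin r → ℝ) × (Fin q → ℝ) × (Fin h → ℝ)) : (Fin r → ℝ) × (Fin h → ℝ) :=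
  (w.1, θ.nu + θ.Lambda *ᵥ θ.latent w + θ.K *ᵥ w.1 + w.2.2)

/-- The law of `(Z, ζ', ε')` in the step-one model with parameter `θ`; `μZ` is the law of `Z`. -/
def StepOneParam.law (L : Matrix (Fin q) (Fin q) ℝ → Measure (Fin q → ℝ))
    (E : Matrix (Fin h) (Fin h) ℝ → Measure (Fin h → ℝ)) (μZ : Measure (Fin r → ℝ))
    (θ : StepOneParam q r h) : Measure ((Fin r → ℝ) × (Fin q → ℝ) × (Fin h → ℝ)) :=
  μZ.prod ((L θ.Psi).prod (E θ.Omega))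

/-- The law of `(Z, X)` in the step-one model with parameter `θ`. -/
def StepOneParam.obsLaw (L : Matrix (Fin q) (Fin q) ℝ → Measure (Fin q → ℝ))
    (E : Matrix (Fin h) (Fin h) ℝ → Measure (Fin h → ℝ)) (μZ : Measure (Fin r → ℝ))
    (θ : StepOneParam q r h) : Measure ((Fin r → ℝ) × (Fin h → ℝ)) :=
  (θ.law L E μZ).map θ.obs

/-- `Θ₁` is an admissible set of step-one parameters for the residual specification `L`, `E`:
the structural equation is uniquely solvable, the diagonal of `B` vanishes, and the residual laws
are centred with covariance matrices `Psi` and `Omega`. -/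
structure IsStepOneSpace (L : Matrix (Fin q) (Fin q) ℝ → Measure (Fin q → ℝ))
    (E : Matrix (Fin h) (Fin h) ℝ → Measure (Fin h → ℝ)) (Θ₁ : Set (StepOneParam q r h)) :
    Prop where
  isCompact : IsCompact Θ₁
  diag_eq_zero : ∀ θ ∈ Θ₁, ∀ i, θ.B i i = 0
  isUnit : ∀ θ ∈ Θ₁, IsUnit (1 - θ.B)
  latent_residual : ∀ θ ∈ Θ₁, IsResidualLaw (L θ.Psi) θ.Psi
  error_residual : ∀ θ ∈ Θ₁, IsResidualLaw (E θ.Omega) θ.Omega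

/-- `dens θ (z, x)` is the conditional density `p_θ(x | z)` of `X` given `Z = z`, for `θ ∈ Θ₁`. -/
structure IsConditionalDensity (L : Matrix (Fin q) (Fin q) ℝ → Measure (Fin q → ℝ))
    (E : Matrix (Fin h) (Fin h) ℝ → Measure (Fin h → ℝ)) (μZ : Measure (Fin r → ℝ))
    (Θ₁ : Set (StepOneParam q r h))
    (dens : StepOneParam q r h → (Fin r → ℝ) × (Fin h → ℝ) → ℝ≥0) : Prop where
  measurable : ∀ θ ∈ Θ₁, Measurable (dens θ)
  obsLaw_eq : ∀ θ ∈ Θ₁,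
    θ.obsLaw L E μZ = (μZ.prod volume).withDensity fun w => (dens θ w : ENNReal)

/-- `pred θ (z, x)` is the conditional mean `E_θ[φ(ξ) | X = x, Z = z]`, for `θ ∈ Θ₁`. -/
structure IsConditionalMean (L : Matrix (Fin q) (Fin q) ℝ → Measure (Fin q → ℝ))
    (E : Matrix (Fin h) (Fin h) ℝ → Measure (Fin h → ℝ)) (μZ : Measure (Fin r → ℝ))
    (φ : (Fin q → ℝ) → Fin l → ℝ) (Θ₁ : Set (StepOneParam q r h))
    (pred : StepOneParam q r h → (Fin r → ℝ) × (Fin h → ℝ) → Fin l → ℝ) : Prop where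
  measurable : ∀ θ ∈ Θ₁, Measurable (pred θ)
  integrable : ∀ θ ∈ Θ₁, Integrable (fun w => φ (θ.latent w)) (θ.law L E μZ)
  ae_eq_condExp : ∀ θ ∈ Θ₁, (fun w => pred θ (θ.obs w)) =ᵐ[θ.law L E μZ]
    (θ.law L E μZ)[fun w => φ (θ.latent w) | MeasurableSpace.comap θ.obs inferInstance]

/-- Step one: `θ` maximises the likelihood of `x₀, …, xₙ₋₁` given `z₀, …, zₙ₋₁` over `Θ₁`, where
`w i = (zᵢ, xᵢ)`. -/
def IsStepOneFit (Θ₁ : Set (StepOneParam q r h))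
    (dens : StepOneParam q r h → (Fin r → ℝ) × (Fin h → ℝ) → ℝ≥0) (n : ℕ)
    (w : ℕ → (Fin r → ℝ) × (Fin h → ℝ)) (θ : StepOneParam q r h) : Prop :=
  θ ∈ Θ₁ ∧ ∀ θ' ∈ Θ₁, ∏ i ∈ Finset.range n, dens θ' (w i) ≤ ∏ i ∈ Finset.range n, dens θ (w i)

/-! ### The step-two model

The linear SEM `η = alpha + B f + Gamma z + ζ`, `Y = nu + Lambda η + K z + ε` in which the
covariates are `z` and the predictions `f`. -/

/-- The modelled mean of `Y` given the covariates `z`, `f`. -/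
def StepTwoParam.mean (θ : StepTwoParam p r l m) (z : Fin r → ℝ) (f : Fin l → ℝ) : Fin m → ℝ :=
  θ.nu + θ.Lambda *ᵥ (θ.alpha + θ.B *ᵥ f + θ.Gamma *ᵥ z) + θ.K *ᵥ z

/-- The modelled covariance matrix of `Y` given the covariates. -/
def StepTwoParam.resCov (θ : StepTwoParam p r l m) : Matrix (Fin m) (Fin m) ℝ :=
  θ.Lambda * θ.Psi * θ.Lambdaᵀ + θ.Omega

/-- The normal log-density of `y` given the covariates (used where `θ.resCov` is positive
definite). -/
def StepTwoParam.logDensity (θ : StepTwoParam p r l m) (z : Fin r → ℝ) (f : Fin l → ℝ)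
    (y : Fin m → ℝ) : ℝ :=
  -(1 / 2) * (m * Real.log (2 * Real.pi) + Real.log θ.resCov.det
    + (y - θ.mean z f) ⬝ᵥ (θ.resCov⁻¹ *ᵥ (y - θ.mean z f)))

/-- The step-two parameter set: the constraints are those of `C₂` on the parameters other than
`Psi`, and `Psi` is an unrestricted covariance matrix. -/
def stepTwoSpace (C₂ : Set (StepTwoCore p r l m)) : Set (StepTwoParam p r l m) :=
  {θ | θ.toStepTwoCore ∈ C₂ ∧ θ.Psi.PosSemidef}

/-- Admissible constraints for step two. The columns of `Lambda` are linearly independent, as is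
the case when every latent outcome has a reference indicator, i.e. when some rows of `Lambda` form
an identity matrix. -/
structure IsStepTwoConstraint (C₂ : Set (StepTwoCore p r l m)) : Prop where
  isCompact : IsCompact C₂
  posSemidef : ∀ κ ∈ C₂, κ.Omega.PosSemidef
  injective : ∀ κ ∈ C₂, Function.Injective fun v => κ.Lambda *ᵥ v

/-- Step two: `θ` maximises the normal likelihood of the linear SEM for `y` given the covariates
`z` and `f`, among the parameters at which that likelihood is defined. -/
def IsStepTwoFit (C₂ : Set (StepTwoCore p r l m)) (n : ℕ) (z : ℕ → Fin r → ℝ)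
    (f : ℕ → Fin l → ℝ) (y : ℕ → Fin m → ℝ) (θ : StepTwoParam p r l m) : Prop :=
  θ ∈ stepTwoSpace C₂ ∧ θ.resCov.PosDef ∧
    ∀ θ' ∈ stepTwoSpace C₂, θ'.resCov.PosDef →
      ∑ i ∈ Finset.range n, θ'.logDensity (z i) (f i) (y i) ≤
        ∑ i ∈ Finset.range n, θ.logDensity (z i) (f i) (y i)

/-- With the covariates `(Z, F)` having their true (unstructured) moments, the step-two model with
parameter `θ` reproduces the mean and the covariance matrix of `(Z, F, Y)`. -/
def InducesMoments {S : Type*} [MeasurableSpace S] (P : Measure S) (Z : S → Fin r → ℝ)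
    (F : S → Fin l → ℝ) (Y : S → Fin m → ℝ) (θ : StepTwoParam p r l m) : Prop :=
  (∀ j, ∫ ω, Y ω j ∂P = ∫ ω, θ.mean (Z ω) (F ω) j ∂P) ∧
  crossCov P Z Y = crossCov P Z (fun ω => θ.mean (Z ω) (F ω)) ∧
  crossCov P F Y = crossCov P F (fun ω => θ.mean (Z ω) (F ω)) ∧
  crossCov P Y Y =
    crossCov P (fun ω => θ.mean (Z ω) (F ω)) (fun ω => θ.mean (Z ω) (F ω)) + θ.resCov

/-! ### The data -/

/-- Independent and identically distributed subjects `i = 0, 1, …` following the non-linear SEM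
with parameters `θ₁`, `θ₂`. Within a subject, the covariates and the four residuals are
independent; `ζ'`, `ε'` follow the laws `L`, `E` of the residual specification, and `ζ`, `ε` have
mean zero and covariance matrices `Psi`, `Omega`. -/
structure IsNonlinearSEM {S : Type*} [MeasurableSpace S] (P : Measure S)
    (φ : (Fin q → ℝ) → Fin l → ℝ)
    (L : Matrix (Fin q) (Fin q) ℝ → Measure (Fin q → ℝ))
    (E : Matrix (Fin h) (Fin h) ℝ → Measure (Fin h → ℝ))
    (μZ : Measure (Fin r → ℝ)) (μζ : Measure (Fin p → ℝ)) (με : Measure (Fin m → ℝ))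
    (θ₁ : StepOneParam q r h) (θ₂ : StepTwoParam p r l m)
    (Z : ℕ → S → Fin r → ℝ) (ξ ζ' : ℕ → S → Fin q → ℝ) (η ζ : ℕ → S → Fin p → ℝ)
    (X ε' : ℕ → S → Fin h → ℝ) (Y ε : ℕ → S → Fin m → ℝ) : Prop where
  structural_outcome : ∀ i ω,
    η i ω = θ₂.alpha + θ₂.B *ᵥ φ (ξ i ω) + θ₂.Gamma *ᵥ Z i ω + ζ i ω
  structural_predictor : ∀ i ω,
    ξ i ω = θ₁.alpha + θ₁.B *ᵥ ξ i ω + θ₁.Gamma *ᵥ Z i ω + ζ' i ω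
  measurement_outcome : ∀ i ω,
    Y i ω = θ₂.nu + θ₂.Lambda *ᵥ η i ω + θ₂.K *ᵥ Z i ω + ε i ω
  measurement_predictor : ∀ i ω,
    X i ω = θ₁.nu + θ₁.Lambda *ᵥ ξ i ω + θ₁.K *ᵥ Z i ω + ε' i ω
  measurable_covariate : ∀ i, Measurable (Z i)
  measurable_residual : ∀ i, Measurable (ζ i) ∧ Measurable (ζ' i) ∧ Measurable (ε i) ∧
    Measurable (ε' i)
  independent : iIndepFun (fun i ω => (Z i ω, ζ i ω, ζ' i ω, ε i ω, ε' i ω)) P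
  law_eq : ∀ i, P.map (fun ω => (Z i ω, ζ i ω, ζ' i ω, ε i ω, ε' i ω)) =
    μZ.prod (μζ.prod ((L θ₁.Psi).prod (με.prod (E θ₁.Omega))))
  covariate_law : IsProbabilityMeasure μZ ∧ MemLp id 2 μZ
  residual_outcome : IsResidualLaw μζ θ₂.Psi
  error_outcome : IsResidualLaw με θ₂.Omega
  measurable_phi : Measurable φ
  finite_variance : ∀ i, MemLp (fun ω => φ (ξ i ω)) 2 P

/-- Regularity of the step-one model at the true parameter `θ₁`: continuity of the likelihood and
of the conditional mean in the parameter, an integrable bound for the log-likelihood ratio, and a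
square integrable bound for the conditional mean near `θ₁`. -/
structure IsStepOneRegular (L : Matrix (Fin q) (Fin q) ℝ → Measure (Fin q → ℝ))
    (E : Matrix (Fin h) (Fin h) ℝ → Measure (Fin h → ℝ)) (μZ : Measure (Fin r → ℝ))
    (Θ₁ : Set (StepOneParam q r h)) (θ₁ : StepOneParam q r h)
    (dens : StepOneParam q r h → (Fin r → ℝ) × (Fin h → ℝ) → ℝ≥0)
    (pred : StepOneParam q r h → (Fin r → ℝ) × (Fin h → ℝ) → Fin l → ℝ) : Prop where
  continuous_dens : ∀ᵐ w ∂(θ₁.obsLaw L E μZ), ContinuousOn (fun θ => dens θ w) Θ₁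
  continuous_pred : ∀ᵐ w ∂(θ₁.obsLaw L E μZ), ContinuousOn (fun θ => pred θ w) Θ₁
  dominated_dens : ∃ G : (Fin r → ℝ) × (Fin h → ℝ) → ℝ, Integrable G (θ₁.obsLaw L E μZ) ∧
    ∀ᵐ w ∂(θ₁.obsLaw L E μZ), ∀ θ ∈ Θ₁, (dens θ w : ℝ) ≤ Real.exp (G w) * dens θ₁ w
  dominated_pred : ∃ U ∈ 𝓝 θ₁, ∃ H : (Fin r → ℝ) × (Fin h → ℝ) → ℝ,
    MemLp H 2 (θ₁.obsLaw L E μZ) ∧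
    ∀ᵐ w ∂(θ₁.obsLaw L E μZ), ∀ θ ∈ U ∩ Θ₁, ‖pred θ w‖ ≤ H w

end TwoStageSEM

end

/-! Why 2SSEM is consistent except for `Psi`. Write `φ(ξ) = φ* + δ` with `φ* = E[φ(ξ) | X, Z]`. The
error `δ` is orthogonal to all square integrable functions of `(X, Z)`, and `ζ`, `ε` are centred and
independent of `(X, Z, ξ)` and of each other. Hence `Y = ν + Λ(α + B φ* + Γ Z + (ζ + B δ)) + K Z +
ε` is, for second moments, an exact linear SEM with covariates `(Z, φ*)`: all coefficients are the
true ones, and the only change is that `Psi` becomes `Psi + B Var(δ) Bᵗ` (`isRegression_condExp`).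
As `Psi` is unrestricted, this parameter `θ₀` lies in the step-two parameter set, and step two
estimates it.

Step one is Wald's consistency argument (`IsIID.tendsto_of_maximises_likelihood`). For a wrong
parameter with likelihood ratio `R`, the truncated log-ratio `log (max R δ)`, now with a small
number `δ > 0`, has mean at most `2 (E √R + √δ - 1)`. This is negative for small `δ`, because the
Hellinger affinity `E √R` of two different laws is less than one. A law of large numbers uniform
near each parameter, together with compactness, excludes maximisers away from the truth.

In step two the normal likelihood depends on the data only through the second moment matrix `M` of
`(1, z, f, y)`. With `f` computed at `θ̂₁`, `M` still converges to the moments of `(1, Z, φ*, Y)`,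
by the same uniform law of large numbers (`IsNonlinearSEM.tendsto_sampleMoments`). The limiting
objective is `tr (A S) - log det A`, where `A` is the precision matrix and `S` the second moment of
the residual. Orthogonality gives `S = Σ₀ + E[d dᵗ]`, where `Σ₀` is the covariance at `θ₀` and `d`
the difference of the modelled means. So the minimum is reached exactly when `A = Σ₀⁻¹` and `d = 0`
almost surely; the first two moments then agree with those of `θ₀`, and identification applies. The
set of `Psi` is not compact, but bounded objective values confine `A` to a compact set of invertible
matrices, and full column rank of `Lambda` recovers `Psi` continuously from `A⁻¹`
(`tendsto_of_objective_le`).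

The almost sure statements hold for all sequences of fits simultaneously, so the estimators need not
be measurable. -/

noncomputable section

namespace TwoStageSEM

/-! ### Laws of large numbers -/

/-- The `V i` are pairwise independent with common law `μ`. -/
structure IsIID {S W : Type*} [MeasurableSpace S] [MeasurableSpace W] (P : Measure S)
    (μ : Measure W) (V : ℕ → S → W) : Prop where
  measurable : ∀ i, Measurable (V i)
  indep : Pairwise fun i j => IndepFun (V i) (V j) P
  map_eq : ∀ i, P.map (V i) = μ

section LawOfLargeNumbers

variable {S W T : Type*} [MeasurableSpace S] [MeasurableSpace W] {P : Measure S}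
  {μ : Measure W} {V : ℕ → S → W}

theorem IsIID.comp {W' : Type*} [MeasurableSpace W'] (hV : IsIID P μ V) {g : W → W'}
    (hg : Measurable g) : IsIID P (μ.map g) (fun i ω => g (V i ω)) where
  measurable i := hg.comp (hV.measurable i)
  indep _ _ hij := (hV.indep hij).comp hg hg
  map_eq i := by
    rw [← hV.map_eq i, Measure.map_map hg (hV.measurable i)]
    rfl

theorem IsIID.ae_forall (hV : IsIID P μ V) {p : W → Prop} (hp : ∀ᵐ w ∂μ, p w) :
    ∀ᵐ ω ∂P, ∀ i, p (V i ω) := by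
  rw [ae_all_iff]
  intro i
  rw [← hV.map_eq i] at hp
  exact ae_of_ae_map (hV.measurable i).aemeasurable hp

theorem IsIID.strong_law (hV : IsIID P μ V) {f : W → ℝ} (hf : Measurable f)
    (hInt : Integrable f μ) :
    ∀ᵐ ω ∂P, Tendsto (fun n : ℕ => (∑ i ∈ Finset.range n, f (V i ω)) / n) atTop
      (𝓝 (∫ w, f w ∂μ)) := by
  have hid : ∀ i, IdentDistrib (fun ω => f (V i ω)) (fun ω => f (V 0 ω)) P P := fun i =>
    IdentDistrib.comp (u := f) ⟨(hV.measurable i).aemeasurable, (hV.measurable 0).aemeasurable,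
      (hV.map_eq i).trans (hV.map_eq 0).symm⟩ hf
  have h0 := hV.map_eq 0
  have hInt' : Integrable (fun ω => f (V 0 ω)) P := by
    rw [← h0] at hInt
    exact hInt.comp_measurable (hV.measurable 0)
  have := strong_law_ae_real (fun i ω => f (V i ω)) hInt'
    (fun i j hij => (hV.indep hij).comp hf hf) hid
  rwa [← integral_map (hV.measurable 0).aemeasurable
    hf.aestronglyMeasurable, h0] at this

/-- A one-sided law of large numbers, uniform near a point of the parameter space. -/
theorem IsIID.eventually_average_lt [TopologicalSpace T] [SecondCountableTopology T]
    (hV : IsIID P μ V) {f : T → W → ℝ} (hf : ∀ θ, Measurable (f θ))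
    (hcont : ∀ᵐ w ∂μ, Continuous fun θ => f θ w) {g : W → ℝ} (hg : Integrable g μ)
    (hle : ∀ᵐ w ∂μ, ∀ θ, |f θ w| ≤ g w) (θ₀ : T) {c : ℝ} (hc : ∫ w, f θ₀ w ∂μ < c) :
    ∃ U ∈ 𝓝 θ₀, ∀ᵐ ω ∂P, ∀ᶠ n : ℕ in atTop, ∀ θ ∈ U,
      (∑ i ∈ Finset.range n, f θ (V i ω)) / n < c := by
  classical
  have : Nonempty T := ⟨θ₀⟩
  obtain ⟨B, hB, hBo⟩ : ∃ B : ℕ → Set T, (𝓝 θ₀).HasAntitoneBasis B ∧ ∀ k, IsOpen (B k) := by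
    obtain ⟨B, hB, hanti⟩ := (nhds_basis_opens θ₀).exists_antitone_subbasis
    exact ⟨B, hanti, fun k => (hB k).2⟩
  have hmem : ∀ k, θ₀ ∈ B k := fun k => mem_of_mem_nhds (hB.mem k)
  -- A dense sequence restricted to `B k`, with default value `θ₀` outside: the supremum `s k` is
  -- over countably many points, hence measurable, and by continuity it dominates `f θ` for all `θ ∈
  -- B k`.
  let pt : ℕ → ℕ → T := fun k j =>
    if TopologicalSpace.denseSeq T j ∈ B k then TopologicalSpace.denseSeq T j else θ₀
  have hpt : ∀ k j, pt k j ∈ B k := fun k j => by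
    by_cases hj : TopologicalSpace.denseSeq T j ∈ B k <;> simp [pt, hj, hmem]
  let s : ℕ → W → ℝ := fun k w => ⨆ j, f (pt k j) w
  have hs : ∀ k, Measurable (s k) := fun k => Measurable.iSup fun j => hf _
  have hbdd : ∀ᵐ w ∂μ, ∀ k, BddAbove (Set.range fun j => f (pt k j) w) := by
    filter_upwards [hle] with w hw k
    exact ⟨g w, by rintro _ ⟨j, rfl⟩; exact (abs_le.1 (hw _)).2⟩
  have hsle : ∀ᵐ w ∂μ, ∀ k, ‖s k w‖ ≤ g w := by
    filter_upwards [hle, hbdd] with w hw hb k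
    refine abs_le.2 ⟨?_, ciSup_le fun j => (abs_le.1 (hw _)).2⟩
    exact (abs_le.1 (hw (pt k 0))).1.trans (le_ciSup (hb k) 0)
  have hdom : ∀ᵐ w ∂μ, ∀ k, ∀ θ ∈ B k, f θ w ≤ s k w := by
    filter_upwards [hcont, hbdd] with w hw hb k θ hθ
    refine le_of_forall_lt fun a ha => ?_
    obtain ⟨x, hx, j, rfl⟩ := (TopologicalSpace.denseRange_denseSeq T).inter_open_nonempty
      (B k ∩ {θ | a < f θ w}) ((hBo k).inter (isOpen_lt continuous_const hw)) ⟨θ, hθ, ha⟩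
    have : pt k j = TopologicalSpace.denseSeq T j := if_pos hx.1
    refine lt_of_lt_of_le hx.2 ?_
    rw [← this]
    exact le_ciSup (hb k) j
  have hlim : ∀ᵐ w ∂μ, Tendsto (fun k => s k w) atTop (𝓝 (f θ₀ w)) := by
    filter_upwards [hcont, hdom] with w hw hd
    refine tendsto_order.2 ⟨fun a ha => Eventually.of_forall fun k => ha.trans_le (hd k θ₀ (hmem k)),
      fun a ha => ?_⟩
    obtain ⟨b, hb, hba⟩ := exists_between ha
    obtain ⟨k, hk⟩ := hB.mem_iff.1 ((isOpen_lt hw continuous_const).mem_nhds hb)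
    filter_upwards [eventually_ge_atTop k] with k' hk'
    exact (ciSup_le fun j => (hk (hB.antitone hk' (hpt k' j))).le).trans_lt hba
  -- The suprema tend to `f θ₀`, so some `s k` has mean below `c`; the strong law for this single
  -- function gives the uniform bound.
  have hconv := tendsto_integral_of_dominated_convergence g
    (fun k => (hs k).aestronglyMeasurable) hg (fun k => hsle.mono fun w hw => hw k) hlim
  obtain ⟨k, hk⟩ := (hconv.eventually (gt_mem_nhds hc)).exists
  refine ⟨B k, hB.mem k, ?_⟩
  have hsint : Integrable (s k) μ :=
    hg.mono' (hs k).aestronglyMeasurable (hsle.mono fun w hw => hw k)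
  filter_upwards [hV.strong_law (hs k) hsint, hV.ae_forall hdom] with ω hω hdω
  filter_upwards [hω.eventually (gt_mem_nhds hk)] with n hn θ hθ
  refine lt_of_le_of_lt ?_ hn
  gcongr with i hi
  exact hdω i k θ hθ

/-- The law of large numbers for a convergent sequence of parameters which may depend on the
sample. -/
theorem IsIID.tendsto_average [TopologicalSpace T] [SecondCountableTopology T]
    (hV : IsIID P μ V) {f : T → W → ℝ} (hf : ∀ θ, Measurable (f θ))
    (hcont : ∀ᵐ w ∂μ, Continuous fun θ => f θ w) {g : W → ℝ} (hg : Integrable g μ)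
    (hle : ∀ᵐ w ∂μ, ∀ θ, |f θ w| ≤ g w) (θ₀ : T) :
    ∀ᵐ ω ∂P, ∀ e : ℕ → T, Tendsto e atTop (𝓝 θ₀) →
      Tendsto (fun n : ℕ => (∑ i ∈ Finset.range n, f (e n) (V i ω)) / n) atTop
        (𝓝 (∫ w, f θ₀ w ∂μ)) := by
  -- Only the countably many margins `1 / (k + 1)` are used, for `f` and for `-f`; the null set is
  -- thus fixed before the sequence `e` is chosen.
  have hup : ∀ᵐ ω ∂P, ∀ k : ℕ, ∃ U ∈ 𝓝 θ₀, ∀ᶠ n : ℕ in atTop, ∀ θ ∈ U,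
      (∑ i ∈ Finset.range n, f θ (V i ω)) / n < ∫ w, f θ₀ w ∂μ + 1 / (k + 1) := by
    rw [ae_all_iff]
    intro k
    obtain ⟨U, hU, h⟩ := hV.eventually_average_lt hf hcont hg hle θ₀
      (lt_add_of_pos_right _ (Nat.one_div_pos_of_nat (α := ℝ) (n := k)))
    exact h.mono fun ω hω => ⟨U, hU, hω⟩
  have hlo : ∀ᵐ ω ∂P, ∀ k : ℕ, ∃ U ∈ 𝓝 θ₀, ∀ᶠ n : ℕ in atTop, ∀ θ ∈ U,
      (∑ i ∈ Finset.range n, -f θ (V i ω)) / n < ∫ w, -f θ₀ w ∂μ + 1 / (k + 1) := by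
    rw [ae_all_iff]
    intro k
    obtain ⟨U, hU, h⟩ := hV.eventually_average_lt (f := fun θ w => -f θ w)
      (fun θ => (hf θ).neg) (hcont.mono fun w hw => hw.neg) hg
      (by simpa only [abs_neg] using hle) θ₀
      (lt_add_of_pos_right _ (Nat.one_div_pos_of_nat (α := ℝ) (n := k)))
    exact h.mono fun ω hω => ⟨U, hU, hω⟩
  filter_upwards [hup, hlo] with ω h1 h2 e he
  refine tendsto_order.2 ⟨fun a ha => ?_, fun a ha => ?_⟩
  · obtain ⟨k, hk⟩ := exists_nat_one_div_lt (sub_pos.2 ha)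
    obtain ⟨U, hU, h⟩ := h2 k
    filter_upwards [h, he hU] with n hn hen
    have := hn _ hen
    rw [Finset.sum_neg_distrib, integral_neg, neg_div] at this
    linarith
  · obtain ⟨k, hk⟩ := exists_nat_one_div_lt (sub_pos.2 ha)
    obtain ⟨U, hU, h⟩ := h1 k
    filter_upwards [h, he hU] with n hn hen
    have := hn _ hen
    linarith

end LawOfLargeNumbers

/-! ### Consistency of maximum likelihood estimators -/

section MaximumLikelihood

variable {S W T : Type*} [MeasurableSpace S] [MeasurableSpace W] {P : Measure S} {ν : Measure W}

theorem ae_withDensity_pos {d : W → ℝ≥0} (hd : Measurable d) :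
    ∀ᵐ w ∂ν.withDensity fun w => (d w : ENNReal), 0 < d w := by
  rw [ae_withDensity_iff hd.coe_nnreal_ennreal]
  refine Eventually.of_forall fun w hw => ?_
  exact pos_iff_ne_zero.2 (by simpa using hw)

/-- The likelihood ratio has mean at most one. -/
theorem lintegral_ratio_le_one {d d₀ : W → ℝ≥0} (hd : Measurable d) (hd₀ : Measurable d₀)
    [hQ : IsProbabilityMeasure (ν.withDensity fun w => (d w : ENNReal))] :
    ∫⁻ w, ((d w / d₀ w : ℝ≥0) : ENNReal) ∂ν.withDensity (fun w => (d₀ w : ENNReal)) ≤ 1 := by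
  have hm : Measurable fun w => ((d w / d₀ w : ℝ≥0) : ENNReal) :=
    (hd.div hd₀).coe_nnreal_ennreal
  rw [lintegral_withDensity_eq_lintegral_mul _ hd₀.coe_nnreal_ennreal hm]
  have h1 : ∫⁻ w, (d w : ENNReal) ∂ν = 1 := by
    have := hQ.measure_univ
    rwa [withDensity_apply _ MeasurableSet.univ, Measure.restrict_univ] at this
  rw [← h1]
  refine lintegral_mono fun w => ?_
  simp only [Pi.mul_apply]
  rw [← ENNReal.coe_mul, ENNReal.coe_le_coe]
  -- Where `d₀` vanishes the quotient is `0` by convention and mass of `d` may be lost, hence only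
  -- an inequality.
  by_cases h : d₀ w = 0
  · simp [h]
  · rw [mul_div_cancel₀ _ h]

/-- Two probability measures whose likelihood ratio is one are equal. -/
theorem withDensity_eq_of_ratio_eq_one {d d₀ : W → ℝ≥0} (hd₀ : Measurable d₀)
    [hQ : IsProbabilityMeasure (ν.withDensity fun w => (d w : ENNReal))]
    [hQ₀ : IsProbabilityMeasure (ν.withDensity fun w => (d₀ w : ENNReal))]
    (h : ∀ᵐ w ∂ν.withDensity (fun w => (d₀ w : ENNReal)), d w / d₀ w = 1) :
    ν.withDensity (fun w => (d w : ENNReal)) = ν.withDensity fun w => (d₀ w : ENNReal) := by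
  rw [ae_withDensity_iff hd₀.coe_nnreal_ennreal] at h
  -- The ratio is known only where `d₀ > 0`, which gives `d₀ ≤ d` almost everywhere; equal total
  -- masses do the rest.
  refine (Measure.eq_of_le_of_measure_univ_eq (withDensity_mono ?_) (by simp)).symm
  filter_upwards [h] with w hw
  rw [ENNReal.coe_le_coe]
  by_cases h0 : d₀ w = 0
  · simp [h0]
  · have := hw (by simpa using h0)
    rw [div_eq_one_iff_eq h0] at this
    exact this.ge

/-- The Hellinger affinity of two different probability measures is less than one. -/
theorem integral_sqrt_ratio_lt_one {d d₀ : W → ℝ≥0} (hd : Measurable d) (hd₀ : Measurable d₀)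
    [hQ : IsProbabilityMeasure (ν.withDensity fun w => (d w : ENNReal))]
    [hQ₀ : IsProbabilityMeasure (ν.withDensity fun w => (d₀ w : ENNReal))]
    (hne : ν.withDensity (fun w => (d w : ENNReal)) ≠ ν.withDensity fun w => (d₀ w : ENNReal)) :
    Integrable (fun w => √((d w / d₀ w : ℝ≥0) : ℝ)) (ν.withDensity fun w => (d₀ w : ENNReal)) ∧
      ∫ w, √((d w / d₀ w : ℝ≥0) : ℝ) ∂ν.withDensity (fun w => (d₀ w : ENNReal)) < 1 := by
  set Q := ν.withDensity fun w => (d₀ w : ENNReal) with hQdef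
  have hle := lintegral_ratio_le_one (ν := ν) hd hd₀
  rw [← hQdef] at hle
  have hRm : Measurable fun w => ((d w / d₀ w : ℝ≥0) : ℝ) := (hd.div hd₀).coe_nnreal_real
  have hRint : Integrable (fun w => ((d w / d₀ w : ℝ≥0) : ℝ)) Q := by
    refine ⟨hRm.aestronglyMeasurable, ?_⟩
    rw [hasFiniteIntegral_iff_enorm]
    refine lt_of_le_of_lt ?_ (hle.trans_lt ENNReal.one_lt_top)
    refine lintegral_mono fun w => ?_
    simp [enorm_eq_nnnorm]
  have hR1 : ∫ w, ((d w / d₀ w : ℝ≥0) : ℝ) ∂Q ≤ 1 := by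
    rw [integral_eq_lintegral_of_nonneg_ae (Eventually.of_forall fun w => NNReal.coe_nonneg _)
      hRm.aestronglyMeasurable]
    refine ENNReal.toReal_le_of_le_ofReal zero_le_one ?_
    simpa only [ENNReal.ofReal_coe_nnreal, ENNReal.ofReal_one] using hle
  have hsint : Integrable (fun w => √((d w / d₀ w : ℝ≥0) : ℝ)) Q := by
    refine (hRint.add (integrable_const (1 : ℝ))).mono' hRm.sqrt.aestronglyMeasurable
      (Eventually.of_forall fun w => ?_)
    rw [Real.norm_of_nonneg (Real.sqrt_nonneg _), Pi.add_apply]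
    have := Real.sq_sqrt (NNReal.coe_nonneg (d w / d₀ w))
    nlinarith [sq_nonneg (√((d w / d₀ w : ℝ≥0) : ℝ) - 1),
      Real.sqrt_nonneg ((d w / d₀ w : ℝ≥0) : ℝ)]
  refine ⟨hsint, lt_of_not_ge fun hge => hne ?_⟩
  -- If `E √R ≥ 1`, then `E (√R - 1)² = E R - 2 E √R + 1 ≤ 1 - 2 + 1 = 0`, so `R = 1` almost
  -- everywhere.
  have hsq : ∀ w, (√((d w / d₀ w : ℝ≥0) : ℝ) - 1) ^ 2 =
      ((d w / d₀ w : ℝ≥0) : ℝ) - 2 * √((d w / d₀ w : ℝ≥0) : ℝ) + 1 := fun w => by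
    have := Real.sq_sqrt (NNReal.coe_nonneg (d w / d₀ w))
    linear_combination this
  have hInt : Integrable (fun w => (√((d w / d₀ w : ℝ≥0) : ℝ) - 1) ^ 2) Q := by
    simp_rw [hsq]
    exact (hRint.sub (hsint.const_mul 2)).add (integrable_const 1)
  have h0 : ∫ w, (√((d w / d₀ w : ℝ≥0) : ℝ) - 1) ^ 2 ∂Q = 0 := by
    refine le_antisymm ?_ (integral_nonneg fun w => sq_nonneg _)
    simp_rw [hsq]
    have hdiff : Integrable
        (fun w => ((d w / d₀ w : ℝ≥0) : ℝ) - 2 * √((d w / d₀ w : ℝ≥0) : ℝ)) Q :=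
      hRint.sub (hsint.const_mul 2)
    rw [integral_add hdiff (integrable_const 1), integral_sub hRint (hsint.const_mul 2), integral_const_mul]
    simp only [integral_const, probReal_univ, smul_eq_mul, one_mul]
    linarith
  rw [integral_eq_zero_iff_of_nonneg (fun w => sq_nonneg _) hInt] at h0
  refine withDensity_eq_of_ratio_eq_one hd₀ ?_
  filter_upwards [h0] with w hw
  have h1 : √((d w / d₀ w : ℝ≥0) : ℝ) = 1 := by
    have := pow_eq_zero_iff (two_ne_zero) |>.1 hw
    linarith
  exact_mod_cast (Real.sqrt_eq_one.1 h1)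

/-- From `log y = 2 log √y ≤ 2 (√y - 1)`. It bounds the mean of a truncated log-likelihood ratio by
the Hellinger affinity. -/
theorem log_max_le {x δ : ℝ} (hδ : 0 < δ) :
    Real.log (max x δ) ≤ 2 * (√x + √δ - 1) := by
  have h0 : 0 < max x δ := lt_max_of_lt_right hδ
  have h1 : Real.log (max x δ) = 2 * Real.log √(max x δ) := by
    rw [Real.log_sqrt h0.le]; ring
  have h2 := Real.log_le_sub_one_of_pos (Real.sqrt_pos.2 h0)
  have h3 : √(max x δ) ≤ √x + √δ := by
    rcases max_cases x δ with ⟨h, -⟩ | ⟨h, -⟩ <;> rw [h]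
    · linarith [Real.sqrt_nonneg δ]
    · linarith [Real.sqrt_nonneg x]
  linarith

/-- Truncation at `δ` turns an upper bound on the log-ratio into the two-sided one which dominated
convergence requires. -/
theorem abs_log_max_le {x δ g : ℝ} (hδ : 0 < δ) (hg : x ≤ Real.exp g) :
    |Real.log (max x δ)| ≤ |g| + |Real.log δ| := by
  have h0 : 0 < max x δ := lt_max_of_lt_right hδ
  refine abs_le.2 ⟨?_, ?_⟩
  · have := Real.log_le_log hδ (le_max_right x δ)
    linarith [neg_abs_le (Real.log δ), abs_nonneg g]
  · rcases max_cases x δ with ⟨h, -⟩ | ⟨h, -⟩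
    · rw [h] at h0 ⊢
      have := Real.log_le_log h0 hg
      rw [Real.log_exp] at this
      linarith [le_abs_self g, abs_nonneg (Real.log δ)]
    · rw [h]
      linarith [le_abs_self (Real.log δ), abs_nonneg g]

/-- Almost surely, all likelihood maximisers over a compact identified model are consistent. -/
theorem IsIID.tendsto_of_maximises_likelihood [TopologicalSpace T] [SecondCountableTopology T]
    {A : Set T} (hA : IsCompact A) {θ₀ : T} (hθ₀ : θ₀ ∈ A) {d : T → W → ℝ≥0} {V : ℕ → S → W}
    (hV : IsIID P (ν.withDensity fun w => (d θ₀ w : ENNReal)) V)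
    (hd : ∀ θ ∈ A, Measurable (d θ))
    (hprob : ∀ θ ∈ A, IsProbabilityMeasure (ν.withDensity fun w => (d θ w : ENNReal)))
    (hid : ∀ θ ∈ A, ν.withDensity (fun w => (d θ w : ENNReal)) =
      ν.withDensity (fun w => (d θ₀ w : ENNReal)) → θ = θ₀)
    (hcont : ∀ᵐ w ∂ν.withDensity (fun w => (d θ₀ w : ENNReal)), ContinuousOn (fun θ => d θ w) A)
    {G : W → ℝ} (hG : Integrable G (ν.withDensity fun w => (d θ₀ w : ENNReal)))
    (hle : ∀ᵐ w ∂ν.withDensity (fun w => (d θ₀ w : ENNReal)), ∀ θ ∈ A,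
      (d θ w : ℝ) ≤ Real.exp (G w) * d θ₀ w) :
    ∀ᵐ ω ∂P, ∀ e : ℕ → T, (∀ᶠ n in atTop, e n ∈ A ∧ ∀ θ ∈ A,
        ∏ i ∈ Finset.range n, d θ (V i ω) ≤ ∏ i ∈ Finset.range n, d (e n) (V i ω)) →
      Tendsto e atTop (𝓝 θ₀) := by
  have hQ₀ := hprob θ₀ hθ₀
  set Q := ν.withDensity fun w => (d θ₀ w : ENNReal) with hQdef
  have hpos : ∀ᵐ w ∂Q, 0 < d θ₀ w := ae_withDensity_pos (hd θ₀ hθ₀)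
  have hV' : ∀ᵐ ω ∂P, ∀ i, 0 < d θ₀ (V i ω) := hV.ae_forall hpos
  -- a neighbourhood of each other parameter contains no maximiser
  have hloc : ∀ θ ∈ A, θ ≠ θ₀ → ∃ U ∈ 𝓝 θ, ∀ᵐ ω ∂P, ∀ᶠ n : ℕ in atTop, ∀ θ' ∈ U ∩ A,
      ∏ i ∈ Finset.range n, d θ' (V i ω) < ∏ i ∈ Finset.range n, d θ₀ (V i ω) := by
    intro θ hθ hne
    have := hprob θ hθ
    obtain ⟨hsint, hlt⟩ := integral_sqrt_ratio_lt_one (hd θ hθ) (hd θ₀ hθ₀)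
      (fun h => hne (hid θ hθ h))
    rw [← hQdef] at hsint hlt
    -- `√δ` is chosen as half the gap between the affinity and one.
    obtain ⟨δ, hδ, hδlt⟩ : ∃ δ : ℝ, 0 < δ ∧
        ∫ w, √((d θ w / d θ₀ w : ℝ≥0) : ℝ) ∂Q + √δ < 1 := by
      refine ⟨((1 - ∫ w, √((d θ w / d θ₀ w : ℝ≥0) : ℝ) ∂Q) / 2) ^ 2, by
        have := sub_pos.2 hlt; positivity, ?_⟩
      rw [Real.sqrt_sq (by linarith)]
      linarith
    let f : A → W → ℝ := fun θ' w => Real.log (max ((d θ' w / d θ₀ w : ℝ≥0) : ℝ) δ)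
    have hfm : ∀ θ', Measurable (f θ') := fun θ' =>
      ((((hd θ' θ'.2).div (hd θ₀ hθ₀)).coe_nnreal_real).max measurable_const).log
    have hfc : ∀ᵐ w ∂Q, Continuous fun θ' => f θ' w := by
      filter_upwards [hcont] with w hw
      have h1 : Continuous fun θ' : A => ((d θ' w / d θ₀ w : ℝ≥0) : ℝ) := by
        have := continuousOn_iff_continuous_domRestrict.1 hw
        push_cast
        exact (NNReal.continuous_coe.comp this).div_const _
      exact (h1.max continuous_const).log fun θ' => (lt_max_of_lt_right hδ).ne'
    have hfle : ∀ᵐ w ∂Q, ∀ θ', |f θ' w| ≤ |G w| + |Real.log δ| := by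
      filter_upwards [hle, hpos] with w hw hp θ'
      refine abs_log_max_le hδ ?_
      rw [NNReal.coe_div]
      exact (div_le_iff₀ (by exact_mod_cast hp)).2 (hw θ' θ'.2)
    have hgint : Integrable (fun w => |G w| + |Real.log δ|) Q :=
      hG.abs.add (integrable_const _)
    have hneg : ∫ w, f ⟨θ, hθ⟩ w ∂Q < 0 := by
      have h1 : ∫ w, f ⟨θ, hθ⟩ w ∂Q ≤
          ∫ w, 2 * (√((d θ w / d θ₀ w : ℝ≥0) : ℝ) + √δ - 1) ∂Q := by
        refine integral_mono (hgint.mono' (hfm _).aestronglyMeasurable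
          (hfle.mono fun w hw => hw _)) ?_ fun w => log_max_le hδ
        exact ((hsint.add (integrable_const _)).sub (integrable_const 1)).const_mul 2
      have hsum : Integrable (fun w => √((d θ w / d θ₀ w : ℝ≥0) : ℝ) + √δ) Q :=
        hsint.add (integrable_const _)
      rw [integral_const_mul, integral_sub hsum (integrable_const 1),
        integral_add hsint (integrable_const _)] at h1
      simp only [integral_const, probReal_univ, smul_eq_mul, one_mul] at h1
      linarith
    obtain ⟨U, hU, h⟩ := hV.eventually_average_lt hfm hfc hgint hfle ⟨θ, hθ⟩ hneg
    obtain ⟨U', hU', hsub⟩ := mem_nhds_induced _ _ _ |>.1 hU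
    refine ⟨U', hU', ?_⟩
    filter_upwards [h, hV'] with ω hω hpω
    filter_upwards [hω, eventually_gt_atTop 0] with n hn hn0 θ' hθ'
    have hsum := hn ⟨θ', hθ'.2⟩ (hsub hθ'.1)
    rw [div_lt_iff₀ (by exact_mod_cast hn0), zero_mul] at hsum
    -- If `θ'` does at least as well as `θ₀`, the product of the ratios is at least one; truncation
    -- only increases it, so the sum of the truncated log-ratios would be nonnegative.
    by_contra hge
    have hge : 1 ≤ ∏ i ∈ Finset.range n, d θ' (V i ω) / d θ₀ (V i ω) := by
      rw [Finset.prod_div_distrib, one_le_div (Finset.prod_pos fun i _ => hpω i)]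
      exact not_lt.1 hge
    have hge2 : (1 : ℝ) ≤
        ∏ i ∈ Finset.range n, max ((d θ' (V i ω) / d θ₀ (V i ω) : ℝ≥0) : ℝ) δ := by
      refine le_trans ?_ (Finset.prod_le_prod (fun i _ => NNReal.coe_nonneg _)
        fun i _ => le_max_left _ _)
      exact_mod_cast hge
    have := Real.log_nonneg hge2
    rw [Real.log_prod (fun i _ => (lt_max_of_lt_right hδ).ne')] at this
    exact absurd hsum (not_lt.2 this)
  -- compactness of the complement of a neighbourhood of `θ₀`
  have hnhds : ∀ U, IsOpen U → θ₀ ∈ U → ∀ᵐ ω ∂P, ∀ᶠ n : ℕ in atTop, ∀ θ' ∈ A \ U,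
      ∏ i ∈ Finset.range n, d θ' (V i ω) < ∏ i ∈ Finset.range n, d θ₀ (V i ω) := by
    intro U hU hmem
    choose! O hO hOlt using hloc
    obtain ⟨t, ht, hcov⟩ := (hA.diff hU).elim_nhds_subcover O fun θ hθ =>
      hO θ hθ.1 fun h => hθ.2 (h ▸ hmem)
    have : ∀ᵐ ω ∂P, ∀ θ ∈ t, ∀ᶠ n : ℕ in atTop, ∀ θ' ∈ O θ ∩ A,
        ∏ i ∈ Finset.range n, d θ' (V i ω) < ∏ i ∈ Finset.range n, d θ₀ (V i ω) := by
      rw [Filter.eventually_all_finset]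
      exact fun θ hθ => hOlt θ (ht θ hθ).1 fun h => (ht θ hθ).2 (h ▸ hmem)
    filter_upwards [this] with ω hω
    rw [← Filter.eventually_all_finset] at hω
    filter_upwards [hω] with n hn θ' hθ'
    obtain ⟨θ, hθ, hmem'⟩ := Set.mem_iUnion₂.1 (hcov hθ')
    exact hn θ hθ θ' ⟨hmem', hθ'.1⟩
  -- A countable basis, so that one null set serves all neighbourhoods and `e` may depend on `ω`.
  obtain ⟨B, hB, hanti⟩ := (nhds_basis_opens θ₀).exists_antitone_subbasis
  have hall : ∀ᵐ ω ∂P, ∀ k, ∀ᶠ n : ℕ in atTop, ∀ θ' ∈ A \ B k,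
      ∏ i ∈ Finset.range n, d θ' (V i ω) < ∏ i ∈ Finset.range n, d θ₀ (V i ω) :=
    ae_all_iff.2 fun k => hnhds (B k) (hB k).2 (hB k).1
  filter_upwards [hall] with ω hω e he
  refine hanti.tendsto_right_iff.2 fun k _ => ?_
  filter_upwards [hω k, he] with n hn hen
  by_contra hnot
  exact absurd (hn (e n) ⟨hen.1, hnot⟩) (not_lt.2 (hen.2 θ₀ hθ₀))

end MaximumLikelihood

/-! ### The normal likelihood as a function of the precision matrix -/

section PrecisionMatrix

variable {n : Type*} [Fintype n] [DecidableEq n]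

open scoped MatrixOrder in
theorem exists_transpose_mul_self {A : Matrix n n ℝ} (hA : A.PosSemidef) :
    ∃ B : Matrix n n ℝ, A = Bᵀ * B := by
  obtain ⟨B, hB⟩ := CStarAlgebra.nonneg_iff_eq_star_mul_self.mp hA.nonneg
  exact ⟨B, by rw [hB, Matrix.star_eq_conjTranspose, Matrix.conjTranspose_eq_transpose_of_trivial]⟩

/-- With `B = Cᵀ C`, cyclicity gives the trace of the positive semidefinite matrix `C A Cᵀ`. -/
theorem trace_mul_nonneg {A B : Matrix n n ℝ} (hA : A.PosSemidef) (hB : B.PosSemidef) :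
    0 ≤ (A * B).trace := by
  obtain ⟨C, rfl⟩ := exists_transpose_mul_self hB
  rw [← Matrix.mul_assoc, Matrix.trace_mul_comm, ← Matrix.mul_assoc]
  simpa [Matrix.conjTranspose_eq_transpose_of_trivial] using
    (hA.mul_mul_conjTranspose_same C).trace_nonneg

/-- The quadratic form at `eᵢ ± eⱼ` is nonnegative, whence `2 |A i j| ≤ A i i + A j j`. -/
theorem abs_apply_le_trace {A : Matrix n n ℝ} (hA : A.PosSemidef) (i j : n) :
    |A i j| ≤ A.trace := by
  have hdiag : ∀ k, 0 ≤ A k k := fun k => hA.diag_nonneg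
  have hsymm : A j i = A i j := by simpa using hA.1.apply i j
  have hquad : ∀ s : ℝ, 0 ≤ A i i + s * (A i j + A j i) + s ^ 2 * A j j := fun s => by
    have := hA.dotProduct_mulVec_nonneg (Pi.single i 1 + s • Pi.single j 1)
    simp only [star_trivial, Matrix.mulVec_add, Matrix.mulVec_smul, Matrix.mulVec_single_one,
      add_dotProduct, dotProduct_add, smul_dotProduct, dotProduct_smul, single_dotProduct,
      Matrix.col_apply, one_mul, smul_eq_mul] at this
    linarith
  have hle : ∀ k, A k k ≤ A.trace := fun k =>
    Finset.single_le_sum (f := fun k => A k k) (fun k _ => hdiag k) (Finset.mem_univ k)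
  have h1 := hquad 1
  have h2 := hquad (-1)
  refine abs_le.2 ⟨?_, ?_⟩ <;> nlinarith [hle i, hle j]

theorem abs_trace_mul_le {A : Matrix n n ℝ} (hA : A.PosSemidef) (D : Matrix n n ℝ) :
    |(A * D).trace| ≤ A.trace * ∑ i, ∑ j, |D i j| := by
  simp only [Matrix.trace, Matrix.diag_apply, Matrix.mul_apply]
  calc |∑ i, ∑ j, A i j * D j i| ≤ ∑ i, ∑ j, A.trace * |D j i| := by
        refine (Finset.abs_sum_le_sum_abs _ _).trans (Finset.sum_le_sum fun i _ => ?_)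
        refine (Finset.abs_sum_le_sum_abs _ _).trans (Finset.sum_le_sum fun j _ => ?_)
        rw [abs_mul]
        gcongr
        exact abs_apply_le_trace hA i j
    _ = _ := by
        rw [Finset.sum_comm]
        simp only [← Finset.mul_sum, Matrix.trace, Matrix.diag_apply]

/-- `tr (A C)` controls the trace of a positive semidefinite matrix `A`, if `C` is positive
definite. -/
theorem exists_trace_le_trace_mul {C : Matrix n n ℝ} (hC : C.PosDef) :
    ∃ c : ℝ, 0 < c ∧ ∀ A : Matrix n n ℝ, A.PosSemidef → c * A.trace ≤ (A * C).trace := by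
  obtain ⟨B, hB⟩ := exists_transpose_mul_self hC.posSemidef
  have hdet : IsUnit C.det := hC.det_pos.ne'.isUnit
  have hBdet : IsUnit B.det := by
    rw [hB, Matrix.det_mul] at hdet
    exact isUnit_of_mul_isUnit_right hdet
  have hBTdet : IsUnit Bᵀ.det := by rwa [Matrix.det_transpose]
  -- With `C = Bᵀ B`, `tr A = tr (B A Bᵀ (Bᵀ)⁻¹ B⁻¹) ≤ k tr (B A Bᵀ) = k tr (A C)`. The constant
  -- uses `k + 1` to stay positive if `k = 0`.
  set k := ∑ i, ∑ j, |((Bᵀ)⁻¹ * B⁻¹) i j|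
  have hk0 : 0 ≤ k := Finset.sum_nonneg fun i _ => Finset.sum_nonneg fun j _ => abs_nonneg _
  refine ⟨(k + 1)⁻¹, by positivity, fun A hA => ?_⟩
  have hQ : (B * A * Bᵀ).PosSemidef := by
    simpa [Matrix.conjTranspose_eq_transpose_of_trivial] using hA.mul_mul_conjTranspose_same B
  have hQtr : (B * A * Bᵀ).trace = (A * C).trace := by
    rw [hB, Matrix.trace_mul_comm, ← Matrix.mul_assoc, Matrix.trace_mul_comm]
  have hAtr : A.trace = (B * A * Bᵀ * ((Bᵀ)⁻¹ * B⁻¹)).trace := by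
    rw [← Matrix.mul_assoc, Matrix.mul_nonsing_inv_cancel_right _ _ hBTdet, Matrix.trace_mul_comm,
      Matrix.nonsing_inv_mul_cancel_left _ _ hBdet]
  have h := (le_abs_self _).trans (abs_trace_mul_le hQ ((Bᵀ)⁻¹ * B⁻¹))
  rw [← hAtr, hQtr] at h
  rw [inv_mul_le_iff₀ (by positivity)]
  have h0 : 0 ≤ (A * C).trace := hQtr ▸ hQ.trace_nonneg
  linarith

/-- The function `x - log x` of the eigenvalues is at least one. -/
theorem card_le_trace_sub_log_det {A : Matrix n n ℝ} (hA : A.PosDef) :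
    (Fintype.card n : ℝ) ≤ A.trace - Real.log A.det := by
  have hpos := hA.eigenvalues_pos
  rw [hA.1.trace_eq_sum_eigenvalues, hA.1.det_eq_prod_eigenvalues]
  simp only [RCLike.ofReal_real_eq_id, id_eq]
  rw [Real.log_prod (fun i _ => (hpos i).ne'), ← Finset.sum_sub_distrib]
  calc (Fintype.card n : ℝ) = ∑ _i : n, (1 : ℝ) := by simp
    _ ≤ _ := Finset.sum_le_sum fun i _ => by
      linarith [Real.log_le_sub_one_of_pos (hpos i)]

/-- Since `log x < x - 1` unless `x = 1`, all eigenvalues must be one; the spectral theorem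
concludes. -/
theorem eq_one_of_trace_sub_log_det_le {A : Matrix n n ℝ} (hA : A.PosDef)
    (h : A.trace - Real.log A.det ≤ Fintype.card n) : A = 1 := by
  have hpos := hA.eigenvalues_pos
  rw [hA.1.trace_eq_sum_eigenvalues, hA.1.det_eq_prod_eigenvalues] at h
  simp only [RCLike.ofReal_real_eq_id, id_eq] at h
  rw [Real.log_prod (fun i _ => (hpos i).ne'), ← Finset.sum_sub_distrib] at h
  have hone : ∀ i, hA.1.eigenvalues i = 1 := by
    by_contra! hne
    obtain ⟨i, hi⟩ := hne
    refine absurd h (not_le.2 ?_)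
    calc (Fintype.card n : ℝ) = ∑ _i : n, (1 : ℝ) := by simp
      _ < _ := Finset.sum_lt_sum (fun j _ => by
          linarith [Real.log_le_sub_one_of_pos (hpos j)])
          ⟨i, Finset.mem_univ i, by linarith [Real.log_lt_sub_one_of_pos (hpos i) hi]⟩
  have hfun : hA.1.eigenvalues = fun _ => 1 := funext hone
  rw [hA.1.spectral_theorem, hfun]
  simp

/-- A bound for the normal likelihood bounds the precision matrix. -/
theorem exists_trace_le_of_trace_sub_log_det_le {c : ℝ} (hc : 0 < c) (t : ℝ) :
    ∃ b : ℝ, ∀ A : Matrix n n ℝ, A.PosDef → c * A.trace - Real.log A.det ≤ t →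
      A.trace ≤ b ∧ Real.exp (-t) ≤ A.det := by
  refine ⟨2 / c * (t + Fintype.card n * (Real.log (2 / c) - 1)), fun A hA h => ⟨?_, ?_⟩⟩
  · have hpos := hA.eigenvalues_pos
    -- Applying `log x ≤ x - 1` to `c / 2` times each eigenvalue lets `log det A` absorb only half
    -- of `c tr A`.
    have hlog : Real.log A.det ≤
        c / 2 * A.trace + Fintype.card n * (Real.log (2 / c) - 1) := by
      rw [hA.1.trace_eq_sum_eigenvalues, hA.1.det_eq_prod_eigenvalues]
      simp only [RCLike.ofReal_real_eq_id, id_eq]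
      rw [Real.log_prod (fun i _ => (hpos i).ne'), Finset.mul_sum, ← nsmul_eq_mul,
        ← Finset.card_univ, ← Finset.sum_const, ← Finset.sum_add_distrib]
      refine Finset.sum_le_sum fun i _ => ?_
      have h1 := Real.log_le_sub_one_of_pos (mul_pos (half_pos hc) (hpos i))
      rw [Real.log_mul (half_pos hc).ne' (hpos i).ne'] at h1
      have h2 : Real.log (2 / c) = -Real.log (c / 2) := by
        rw [← Real.log_inv, inv_div]
      linarith
    have h3 : c / 2 * A.trace ≤ t + Fintype.card n * (Real.log (2 / c) - 1) := by linarith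
    calc A.trace = 2 / c * (c / 2 * A.trace) := by field_simp
      _ ≤ _ := by gcongr
  · have h0 : 0 ≤ c * A.trace := mul_nonneg hc.le hA.posSemidef.trace_nonneg
    rw [← Real.exp_log hA.det_pos]
    exact Real.exp_le_exp.2 (by linarith)

/-- The normal likelihood with true covariance matrix `C` is maximal at the precision `C⁻¹`. -/
theorem card_add_log_det_le {C A : Matrix n n ℝ} (hC : C.PosDef) (hA : A.PosDef) :
    Fintype.card n + Real.log C.det ≤ (A * C).trace - Real.log A.det ∧
      ((A * C).trace - Real.log A.det ≤ Fintype.card n + Real.log C.det → A = C⁻¹) := by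
  obtain ⟨B, hB⟩ := exists_transpose_mul_self hC.posSemidef
  have hBdet : IsUnit B.det := by
    have hdet : IsUnit C.det := hC.det_pos.ne'.isUnit
    rw [hB, Matrix.det_mul] at hdet
    exact isUnit_of_mul_isUnit_right hdet
  -- The congruence by `B`, where `C = Bᵀ B`, reduces to the case `C = 1`: the trace becomes `tr (A
  -- C)` and the determinant `det A det C`.
  have hQ : (B * A * Bᵀ).PosDef := by
    have := (Matrix.IsUnit.posDef_star_right_conjugate_iff
      ((Matrix.isUnit_iff_isUnit_det B).2 hBdet)).2 hA
    simpa [Matrix.star_eq_conjTranspose, Matrix.conjTranspose_eq_transpose_of_trivial] using this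
  have hQtr : (B * A * Bᵀ).trace = (A * C).trace := by
    rw [hB, Matrix.trace_mul_comm, ← Matrix.mul_assoc, Matrix.trace_mul_comm]
  have hQdet : Real.log (B * A * Bᵀ).det = Real.log A.det + Real.log C.det := by
    rw [← Real.log_mul hA.det_pos.ne' hC.det_pos.ne', hB]
    simp only [Matrix.det_mul]
    ring_nf
  have h1 := card_le_trace_sub_log_det hQ
  have h2 := eq_one_of_trace_sub_log_det_le hQ
  rw [hQtr, hQdet] at h1 h2
  refine ⟨by linarith, fun h => ?_⟩
  have h3 := h2 (by linarith)
  symm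
  refine Matrix.inv_eq_right_inv ?_
  have h4 : A * Bᵀ = B⁻¹ :=
    (Matrix.inv_eq_right_inv (by rw [← Matrix.mul_assoc, h3])).symm
  have h5 : A * C = 1 := by
    rw [hB, ← Matrix.mul_assoc, h4, Matrix.nonsing_inv_mul _ hBdet]
  exact mul_eq_one_comm.1 h5

/-- Precision matrices with bounded likelihood values stay in a compact set. -/
theorem exists_precision_bound {ι : Type*} {F : Filter ι} {A R : ι → Matrix n n ℝ}
    {C R₀ : Matrix n n ℝ} (hR : Tendsto R F (𝓝 R₀)) (hC : C.PosDef)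
    (hRC : (R₀ - C).PosSemidef) {t : ℝ} (hA : ∀ᶠ k in F, (A k).PosDef)
    (hle : ∀ᶠ k in F, (A k * R k).trace - Real.log (A k).det ≤ t) :
    ∃ a b : ℝ, 0 < a ∧ ∀ᶠ k in F, a ≤ (A k).det ∧ ∀ i j, A k i j ∈ Set.Icc (-b) b := by
  obtain ⟨c, hc, hcle⟩ := exists_trace_le_trace_mul hC
  obtain ⟨b, hb⟩ := exists_trace_le_of_trace_sub_log_det_le (n := n) (half_pos hc) t
  refine ⟨Real.exp (-t), b, Real.exp_pos _, ?_⟩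
  have hdiff : Tendsto (fun k => ∑ i, ∑ j, |(R k - R₀) i j|) F (𝓝 0) := by
    have hcts : Continuous fun D : Matrix n n ℝ => ∑ i, ∑ j, |(D - R₀) i j| := by
      refine continuous_finsetSum _ fun i _ => continuous_finsetSum _ fun j _ => ?_
      exact ((continuous_id.sub continuous_const).matrix_elem i j).abs
    simpa [Function.comp_def] using (hcts.tendsto R₀).comp hR
  filter_upwards [hA, hle, hdiff.eventually (gt_mem_nhds (half_pos hc))] with k hAk hlek hk
  have hps := hAk.posSemidef
  -- Of the three terms, the first is at least `c tr A`, the second is nonnegative and the third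
  -- eventually at least `-(c / 2) tr A`. So `(c / 2) tr A - log det A ≤ t`, which bounds the trace
  -- above and the determinant below.
  have h1 : (A k * R k).trace =
      (A k * C).trace + (A k * (R₀ - C)).trace + (A k * (R k - R₀)).trace := by
    rw [← Matrix.trace_add, ← Matrix.trace_add, ← Matrix.mul_add, ← Matrix.mul_add]
    congr 2
    abel
  have h2 := hcle _ hps
  have h3 := trace_mul_nonneg hps hRC
  have h4 := (abs_le.1 (abs_trace_mul_le hps (R k - R₀))).1
  have h5 : (A k).trace * ∑ i, ∑ j, |(R k - R₀) i j| ≤ (A k).trace * (c / 2) :=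
    mul_le_mul_of_nonneg_left hk.le hps.trace_nonneg
  obtain ⟨h6, h7⟩ := hb (A k) hAk (by linarith)
  exact ⟨h7, fun i j => abs_le.1 ((abs_apply_le_trace hps i j).trans h6)⟩

end PrecisionMatrix

/-! ### The step-two likelihood -/

section StepTwo

variable {p r l m : ℕ}

theorem StepTwoCore.continuous_toProd :
    Continuous (StepTwoCore.toProd : StepTwoCore p r l m → _) :=
  continuous_induced_dom

theorem StepTwoCore.continuous_Lambda :
    Continuous (StepTwoCore.Lambda : StepTwoCore p r l m → _) :=
  StepTwoCore.continuous_toProd.snd.snd.snd.snd.fst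

theorem StepTwoCore.continuous_Omega :
    Continuous (StepTwoCore.Omega : StepTwoCore p r l m → _) :=
  StepTwoCore.continuous_toProd.snd.snd.snd.snd.snd.snd

/-- Positions of the vector `(1, z, f, y)` of observations of a subject. -/
abbrev ObsIndex (r l m : ℕ) : Type := Unit ⊕ Fin r ⊕ Fin l ⊕ Fin m

/-- The vector `(1, z, f, y)` of observations of a subject. -/
def obsVec (z : Fin r → ℝ) (f : Fin l → ℝ) (y : Fin m → ℝ) : ObsIndex r l m → ℝ :=
  Sum.elim (fun _ => 1) (Sum.elim z (Sum.elim f y))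

/-- The matrix which maps the vector of observations to the residual of `y`. -/
def StepTwoCore.residualMatrix (κ : StepTwoCore p r l m) :
    Matrix (Fin m) (ObsIndex r l m) ℝ :=
  Matrix.of fun a => Sum.elim (fun _ => -(κ.nu + κ.Lambda *ᵥ κ.alpha) a)
    (Sum.elim (fun j => -(κ.Lambda * κ.Gamma + κ.K) a j)
      (Sum.elim (fun j => -(κ.Lambda * κ.B) a j) fun b => (1 : Matrix (Fin m) (Fin m) ℝ) a b))

theorem StepTwoCore.continuous_residualMatrix :
    Continuous (StepTwoCore.residualMatrix : StepTwoCore p r l m → _) := by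
  have h := StepTwoCore.continuous_toProd (p := p) (r := r) (l := l) (m := m)
  have halpha : Continuous (StepTwoCore.alpha : StepTwoCore p r l m → _) := h.fst
  have hB : Continuous (StepTwoCore.B : StepTwoCore p r l m → _) := h.snd.fst
  have hGamma : Continuous (StepTwoCore.Gamma : StepTwoCore p r l m → _) := h.snd.snd.fst
  have hnu : Continuous (StepTwoCore.nu : StepTwoCore p r l m → _) := h.snd.snd.snd.fst
  have hLambda := StepTwoCore.continuous_Lambda (p := p) (r := r) (l := l) (m := m)
  have hK : Continuous (StepTwoCore.K : StepTwoCore p r l m → _) :=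
    h.snd.snd.snd.snd.snd.fst
  refine continuous_matrix fun a c => ?_
  rcases c with c | c | c | c
  · exact ((continuous_apply a).comp (hnu.add (hLambda.matrix_mulVec halpha))).neg
  · exact (((hLambda.matrix_mul hGamma).add hK).matrix_elem a c).neg
  · exact ((hLambda.matrix_mul hB).matrix_elem a c).neg
  · exact continuous_const

/-- Linearity in `(1, z, f, y)`, with coefficients free of the data and of `Psi`, is what reduces
the likelihood to second moments. -/
theorem StepTwoParam.sub_mean_eq (θ : StepTwoParam p r l m) (z : Fin r → ℝ) (f : Fin l → ℝ)
    (y : Fin m → ℝ) : y - θ.mean z f = θ.residualMatrix *ᵥ obsVec z f y := by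
  ext a
  have h1 : (1 : Matrix (Fin m) (Fin m) ℝ) *ᵥ y = y := Matrix.one_mulVec y
  have h1a := congrFun h1 a
  simp only [Matrix.mulVec, dotProduct] at h1a
  simp only [StepTwoParam.mean, Matrix.mulVec_add, Matrix.mulVec_mulVec]
  simp only [StepTwoCore.residualMatrix, obsVec, Matrix.mulVec, dotProduct, Fintype.sum_sum_type,
    Matrix.of_apply, Sum.elim_inl, Sum.elim_inr, h1a, Pi.sub_apply, Pi.add_apply,
    Matrix.add_apply, add_mul, neg_mul, Finset.sum_neg_distrib, Finset.sum_add_distrib,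
    Finset.univ_unique, Finset.sum_singleton, mul_one]
  ring

/-- The matrix of second empirical moments of `v`. -/
def sampleMoments {ι : Type*} (n : ℕ) (v : ℕ → ι → ℝ) : Matrix ι ι ℝ :=
  Matrix.of fun c d => (∑ i ∈ Finset.range n, v i c * v i d) / n

theorem trace_mul_sampleMoments {ι : Type*} [Fintype ι] {k : ℕ} (A : Matrix (Fin k) (Fin k) ℝ)
    (D : Matrix (Fin k) ι ℝ) (n : ℕ) (v : ℕ → ι → ℝ) :
    (A * (D * sampleMoments n v * Dᵀ)).trace =
      (∑ i ∈ Finset.range n, (D *ᵥ v i) ⬝ᵥ (A *ᵥ (D *ᵥ v i))) / n := by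
  have hs : sampleMoments n v =
      ∑ i ∈ Finset.range n, (n : ℝ)⁻¹ • Matrix.vecMulVec (v i) (v i) := by
    ext c d
    simp only [sampleMoments, Matrix.of_apply, Matrix.sum_apply, Matrix.smul_apply,
      Matrix.vecMulVec_apply, smul_eq_mul, ← Finset.mul_sum]
    ring
  rw [hs, Matrix.mul_sum, Matrix.sum_mul, Matrix.mul_sum, Matrix.trace_sum, Finset.sum_div]
  refine Finset.sum_congr rfl fun i _ => ?_
  rw [Matrix.mul_smul, Matrix.smul_mul, Matrix.mul_smul, Matrix.trace_smul, Matrix.mul_vecMulVec,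
    Matrix.vecMulVec_mul, Matrix.mul_vecMulVec, Matrix.trace_vecMulVec, Matrix.vecMul_transpose,
    dotProduct_comm, smul_eq_mul]
  ring

/-- Minus twice the normalised step-two log-likelihood, up to a constant, as a function of the
precision matrix `A` of `Y` and of the matrix `M` of second moments of the observations. -/
def StepTwoCore.objective (κ : StepTwoCore p r l m)
    (M : Matrix (ObsIndex r l m) (ObsIndex r l m) ℝ) (A : Matrix (Fin m) (Fin m) ℝ) : ℝ :=
  (A * (κ.residualMatrix * M * κ.residualMatrixᵀ)).trace - Real.log A.det

/-- The sum of the quadratic forms is a trace against the empirical moments, so the data enter only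
through `sampleMoments`; the factor `-(n / 2)` turns maximisation into minimisation of `objective`.
-/
theorem StepTwoParam.sum_logDensity (θ : StepTwoParam p r l m) {n : ℕ} (hn : 0 < n)
    (z : ℕ → Fin r → ℝ) (f : ℕ → Fin l → ℝ) (y : ℕ → Fin m → ℝ) :
    ∑ i ∈ Finset.range n, θ.logDensity (z i) (f i) (y i) = -(n / 2) * (m * Real.log (2 * Real.pi) +
      θ.objective (sampleMoments n fun i => obsVec (z i) (f i) (y i)) θ.resCov⁻¹) := by
  have hn' : (n : ℝ) ≠ 0 := by exact_mod_cast hn.ne'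
  have hdet : Real.log (θ.resCov⁻¹).det = -Real.log θ.resCov.det := by
    rw [Matrix.det_nonsing_inv, Ring.inverse_eq_inv', Real.log_inv]
  simp only [StepTwoParam.logDensity, StepTwoCore.objective, trace_mul_sampleMoments, hdet,
    StepTwoParam.sub_mean_eq]
  rw [← Finset.mul_sum, Finset.sum_add_distrib, Finset.sum_const, Finset.card_range, nsmul_eq_mul]
  field_simp
  ring

theorem IsStepTwoFit.objective_le {C₂ : Set (StepTwoCore p r l m)} {n : ℕ} (hn : 0 < n)
    {z : ℕ → Fin r → ℝ} {f : ℕ → Fin l → ℝ} {y : ℕ → Fin m → ℝ} {θ θ' : StepTwoParam p r l m}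
    (h : IsStepTwoFit C₂ n z f y θ) (hθ' : θ' ∈ stepTwoSpace C₂) (hpos : θ'.resCov.PosDef) :
    θ.objective (sampleMoments n fun i => obsVec (z i) (f i) (y i)) θ.resCov⁻¹ ≤
      θ'.objective (sampleMoments n fun i => obsVec (z i) (f i) (y i)) θ'.resCov⁻¹ := by
  have := h.2.2 θ' hθ' hpos
  rw [StepTwoParam.sum_logDensity _ hn, StepTwoParam.sum_logDensity _ hn] at this
  have hn' : (0 : ℝ) < n / 2 := by positivity
  rw [neg_mul, neg_mul, neg_le_neg_iff, mul_le_mul_iff_right₀ hn'] at this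
  linarith

theorem isUnit_det_transpose_mul_self {D : Matrix (Fin m) (Fin p) ℝ}
    (hD : Function.Injective fun v => D *ᵥ v) : IsUnit (Dᵀ * D).det := by
  have := Matrix.PosDef.conjTranspose_mul_self D hD
  rw [Matrix.conjTranspose_eq_transpose_of_trivial] at this
  exact this.det_pos.ne'.isUnit

/-- `Psi` as a function of the other parameters and of the covariance matrix of `Y`. -/
theorem StepTwoParam.Psi_eq (θ : StepTwoParam p r l m)
    (hΛ : Function.Injective fun v => θ.Lambda *ᵥ v) :
    θ.Psi = (θ.Lambdaᵀ * θ.Lambda)⁻¹ * θ.Lambdaᵀ * (θ.resCov - θ.Omega) *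
      (θ.Lambda * ((θ.Lambdaᵀ * θ.Lambda)⁻¹)) := by
  have hu := isUnit_det_transpose_mul_self hΛ
  rw [StepTwoParam.resCov, add_sub_cancel_right]
  -- `(Λᵗ Λ)⁻¹ Λᵗ` is a left inverse of `Λ`; it is applied on the left and its transpose on the
  -- right.
  calc θ.Psi = ((θ.Lambdaᵀ * θ.Lambda)⁻¹ * (θ.Lambdaᵀ * θ.Lambda)) * θ.Psi *
        ((θ.Lambdaᵀ * θ.Lambda) * (θ.Lambdaᵀ * θ.Lambda)⁻¹) := by
        rw [Matrix.nonsing_inv_mul _ hu, Matrix.mul_nonsing_inv _ hu, Matrix.one_mul,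
          Matrix.mul_one]
    _ = _ := by simp only [Matrix.mul_assoc]

theorem tendsto_matrix_mul {ι i j k : Type*} [Fintype j] {F : Filter ι} {A : ι → Matrix i j ℝ}
    {B : ι → Matrix j k ℝ} {A₀ : Matrix i j ℝ} {B₀ : Matrix j k ℝ} (hA : Tendsto A F (𝓝 A₀))
    (hB : Tendsto B F (𝓝 B₀)) : Tendsto (fun n => A n * B n) F (𝓝 (A₀ * B₀)) :=
  ((continuous_fst.matrix_mul continuous_snd).tendsto (A₀, B₀)).comp (hA.prodMk_nhds hB)

theorem tendsto_matrix_inv {ι : Type*} {F : Filter ι} {k : ℕ} {A : ι → Matrix (Fin k) (Fin k) ℝ}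
    {A₀ : Matrix (Fin k) (Fin k) ℝ} (h : Tendsto A F (𝓝 A₀)) (hA₀ : IsUnit A₀.det) :
    Tendsto (fun i => (A i)⁻¹) F (𝓝 A₀⁻¹) := by
  refine (continuousAt_matrix_inv A₀ ?_).tendsto.comp h
  rw [Ring.inverse_eq_inv']
  exact continuousAt_inv₀ hA₀.ne_zero

theorem posSemidef_of_tendsto {ι : Type*} {F : Filter ι} [F.NeBot] {k : ℕ}
    {A : ι → Matrix (Fin k) (Fin k) ℝ} {A₀ : Matrix (Fin k) (Fin k) ℝ} (h : Tendsto A F (𝓝 A₀))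
    (hA : ∀ᶠ i in F, (A i).PosSemidef) : A₀.PosSemidef := by
  refine .of_dotProduct_mulVec_nonneg ?_ fun x => ?_
  · have h1 : Tendsto (fun i => (A i)ᴴ) F (𝓝 A₀ᴴ) :=
      ((continuous_id.matrix_conjTranspose).tendsto A₀).comp h
    exact tendsto_nhds_unique (h1.congr' (hA.mono fun i hi => hi.1)) h
  · have hc : Continuous fun B : Matrix (Fin k) (Fin k) ℝ => star x ⬝ᵥ (B *ᵥ x) :=
      continuous_const.dotProduct (continuous_id.matrix_mulVec continuous_const)
    exact ge_of_tendsto ((hc.tendsto A₀).comp h)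
      (hA.mono fun i hi => hi.dotProduct_mulVec_nonneg x)

/-- Consistency of the step-two fit when the second moments of the observations converge to a
limit `M₀` at which the likelihood is maximal and identified at `θ₀`. -/
theorem tendsto_of_objective_le {C₂ : Set (StepTwoCore p r l m)} (hC₂ : IsStepTwoConstraint C₂)
    {θ₀ : StepTwoParam p r l m} (hpos : θ₀.resCov.PosDef)
    {M₀ : Matrix (ObsIndex r l m) (ObsIndex r l m) ℝ}
    (hmin : ∀ θ : StepTwoParam p r l m,
      (θ.residualMatrix * M₀ * θ.residualMatrixᵀ - θ₀.resCov).PosSemidef)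
    (heq : θ₀.residualMatrix * M₀ * θ₀.residualMatrixᵀ = θ₀.resCov)
    (hid : ∀ θ ∈ stepTwoSpace C₂, θ.residualMatrix * M₀ * θ.residualMatrixᵀ = θ₀.resCov →
      θ.resCov = θ₀.resCov → θ = θ₀)
    {M : ℕ → Matrix (ObsIndex r l m) (ObsIndex r l m) ℝ} (hM : Tendsto M atTop (𝓝 M₀))
    {e : ℕ → StepTwoParam p r l m}
    (he : ∀ᶠ n in atTop, e n ∈ stepTwoSpace C₂ ∧ (e n).resCov.PosDef ∧
      (e n).objective (M n) (e n).resCov⁻¹ ≤ θ₀.objective (M n) θ₀.resCov⁻¹) :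
    Tendsto (fun n => (e n).toStepTwoCore) atTop (𝓝 θ₀.toStepTwoCore) ∧
      Tendsto (fun n => (e n).Psi) atTop (𝓝 θ₀.Psi) := by
  have hquad : ∀ A : Matrix (Fin m) (ObsIndex r l m) ℝ,
      Continuous fun N : Matrix (ObsIndex r l m) (ObsIndex r l m) ℝ => A * N * Aᵀ := fun A =>
    (continuous_const.matrix_mul continuous_id).matrix_mul continuous_const
  have hobj₀ : Tendsto (fun n => θ₀.objective (M n) θ₀.resCov⁻¹) atTop
      (𝓝 (θ₀.objective M₀ θ₀.resCov⁻¹)) := by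
    have hc : Continuous fun N => θ₀.objective N θ₀.resCov⁻¹ :=
      (continuous_const.matrix_mul (hquad _)).matrix_trace.sub continuous_const
    exact (hc.tendsto M₀).comp hM
  have hobj₀eq : θ₀.objective M₀ θ₀.resCov⁻¹ = Fintype.card (Fin m) + Real.log θ₀.resCov.det := by
    rw [StepTwoCore.objective, heq, Matrix.nonsing_inv_mul _ hpos.det_pos.ne'.isUnit,
      Matrix.trace_one, Matrix.det_nonsing_inv, Ring.inverse_eq_inv', Real.log_inv, sub_neg_eq_add]
  -- Along an ultrafilter, sequences in compact sets converge, which replaces passing to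
  -- subsequences.
  suffices key : ∀ g : Ultrafilter ℕ, ↑g ≤ (atTop : Filter ℕ) →
      Tendsto (fun n => (e n).toStepTwoCore) g (𝓝 θ₀.toStepTwoCore) ∧
        Tendsto (fun n => (e n).Psi) g (𝓝 θ₀.Psi) from
    ⟨(tendsto_iff_ultrafilter _ _ _).2 fun g hg => (key g hg).1,
      (tendsto_iff_ultrafilter _ _ _).2 fun g hg => (key g hg).2⟩
  intro g hg
  have heg := he.filter_mono hg
  have hMg := hM.mono_left hg
  have hobjg := hobj₀.mono_left hg
  obtain ⟨κ, hκ, hκlim⟩ := hC₂.isCompact.ultrafilter_le_nhds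
    (g.map fun n => (e n).toStepTwoCore) (le_principal_iff.2 (heg.mono fun n hn => hn.1.1))
  replace hκlim : Tendsto (fun n => (e n).toStepTwoCore) g (𝓝 κ) := hκlim
  have hD : Tendsto (fun n => (e n).residualMatrix) g (𝓝 κ.residualMatrix) :=
    (StepTwoCore.continuous_residualMatrix.tendsto κ).comp hκlim
  have hS : Tendsto (fun n => (e n).residualMatrix * M n * (e n).residualMatrixᵀ) g
      (𝓝 (κ.residualMatrix * M₀ * κ.residualMatrixᵀ)) :=
    tendsto_matrix_mul (tendsto_matrix_mul hD hMg)
      ((continuous_id.matrix_transpose.tendsto _).comp hD)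
  have hSmin : (κ.residualMatrix * M₀ * κ.residualMatrixᵀ - θ₀.resCov).PosSemidef :=
    hmin ⟨κ, 0⟩
  -- The objective at `e n` is at most that at `θ₀`, eventually below its limit plus one. This keeps
  -- the precision matrices bounded, with determinant at least `a > 0`, so their limit `A` is
  -- invertible.
  obtain ⟨a, b, ha, hab⟩ := exists_precision_bound hS hpos hSmin
    (A := fun n => (e n).resCov⁻¹) (t := θ₀.objective M₀ θ₀.resCov⁻¹ + 1)
    (heg.mono fun n hn => hn.2.1.inv) (by
      filter_upwards [heg, hobjg.eventually (gt_mem_nhds (lt_add_one _))] with n hn hn'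
      exact hn.2.2.trans hn'.le)
  obtain ⟨A, -, hA⟩ := (isCompact_Icc (a := -b) (b := b)).matrix.ultrafilter_le_nhds
    (g.map fun n => (e n).resCov⁻¹) (le_principal_iff.2 (hab.mono fun n hn => hn.2))
  replace hA : Tendsto (fun n => (e n).resCov⁻¹) g (𝓝 A) := hA
  have hAdet : Tendsto (fun n => ((e n).resCov⁻¹).det) g (𝓝 A.det) :=
    ((continuous_id.matrix_det).tendsto A).comp hA
  have hAdet0 : A.det ≠ 0 :=
    (ha.trans_le (ge_of_tendsto hAdet (hab.mono fun n hn => hn.1))).ne'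
  have hApos : A.PosDef := (posSemidef_of_tendsto hA
    (heg.mono fun n hn => hn.2.1.inv.posSemidef)).posDef_iff_det_ne_zero.2 hAdet0
  have hcov : Tendsto (fun n => (e n).resCov) g (𝓝 A⁻¹) := by
    refine (tendsto_matrix_inv hA hAdet0.isUnit).congr' ?_
    filter_upwards [heg] with n hn
    exact Matrix.nonsing_inv_nonsing_inv _ hn.2.1.det_pos.ne'.isUnit
  have hΛ : Tendsto (fun n => (e n).Lambda) g (𝓝 κ.Lambda) :=
    (StepTwoCore.continuous_Lambda.tendsto κ).comp hκlim
  have hΩ : Tendsto (fun n => (e n).Omega) g (𝓝 κ.Omega) :=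
    (StepTwoCore.continuous_Omega.tendsto κ).comp hκlim
  have hΛT : Tendsto (fun n => (e n).Lambdaᵀ) g (𝓝 κ.Lambdaᵀ) :=
    (continuous_id.matrix_transpose.tendsto _).comp hΛ
  have hΓ := tendsto_matrix_inv (tendsto_matrix_mul hΛT hΛ)
    (isUnit_det_transpose_mul_self (hC₂.injective κ hκ))
  -- No compactness is assumed for `Psi`: it converges as a continuous function of `Lambda`, `Omega`
  -- and the covariance, since the limiting `Lambda` also has full column rank.
  have hΨ := (tendsto_matrix_mul (tendsto_matrix_mul (tendsto_matrix_mul hΓ hΛT) (hcov.sub hΩ)) (tendsto_matrix_mul hΛ hΓ)).congr'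
    (heg.mono fun n hn => ((e n).Psi_eq (hC₂.injective _ hn.1.1)).symm)
  generalize (κ.Lambdaᵀ * κ.Lambda)⁻¹ * κ.Lambdaᵀ * (A⁻¹ - κ.Omega) *
      (κ.Lambda * (κ.Lambdaᵀ * κ.Lambda)⁻¹) = Ψ at hΨ
  let θ : StepTwoParam p r l m := ⟨κ, Ψ⟩
  have hθ : θ ∈ stepTwoSpace C₂ :=
    ⟨hκ, posSemidef_of_tendsto hΨ (heg.mono fun n hn => hn.1.2)⟩
  have hθcov : θ.resCov = A⁻¹ :=
    tendsto_nhds_unique ((tendsto_matrix_mul (tendsto_matrix_mul hΛ hΨ) hΛT).add hΩ) hcov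
  have hobj : Tendsto (fun n => (e n).objective (M n) (e n).resCov⁻¹) g (𝓝 (κ.objective M₀ A)) :=
    (((continuous_id.matrix_trace).tendsto _).comp (tendsto_matrix_mul hA hS)).sub (hAdet.log hAdet0)
  -- With `Σ₀ = θ₀.resCov` and `S` the limiting residual moment, `m + log det Σ₀ ≤ tr (A Σ₀) - log
  -- det A ≤ tr (A S) - log det A ≤ m + log det Σ₀`. Equality throughout gives `A = Σ₀⁻¹` and `tr (A
  -- (S - Σ₀)) = 0`, hence `S = Σ₀`.
  have hle := le_of_tendsto_of_tendsto hobj hobjg (heg.mono fun n hn => hn.2.2)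
  rw [hobj₀eq, StepTwoCore.objective] at hle
  have hsplit : (A * (κ.residualMatrix * M₀ * κ.residualMatrixᵀ)).trace = (A * θ₀.resCov).trace +
      (A * (κ.residualMatrix * M₀ * κ.residualMatrixᵀ - θ₀.resCov)).trace := by
    rw [← Matrix.trace_add, ← Matrix.mul_add, add_sub_cancel]
  have hnn := trace_mul_nonneg hApos.posSemidef hSmin
  obtain ⟨h1, h2⟩ := card_add_log_det_le hpos hApos
  have hAeq : A = θ₀.resCov⁻¹ := h2 (by linarith)
  have hzero : κ.residualMatrix * M₀ * κ.residualMatrixᵀ - θ₀.resCov = 0 := by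
    obtain ⟨c, hc, hcle⟩ := exists_trace_le_trace_mul hApos
    have h3 := hcle _ hSmin
    rw [Matrix.trace_mul_comm] at h3
    have h4 : c * (κ.residualMatrix * M₀ * κ.residualMatrixᵀ - θ₀.resCov).trace ≤ 0 := by linarith
    refine hSmin.trace_eq_zero_iff.1 (le_antisymm ?_ hSmin.trace_nonneg)
    exact nonpos_of_mul_nonpos_right h4 hc
  have hfin : θ = θ₀ := hid θ hθ (sub_eq_zero.1 hzero) (by
    rw [hθcov, hAeq, Matrix.nonsing_inv_nonsing_inv _ hpos.det_pos.ne'.isUnit])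
  rw [← hfin]
  exact ⟨hκlim, hΨ⟩

end StepTwo

/-! ### Second moments -/

section SecondMoments

variable {S : Type*} [MeasurableSpace S] {P : Measure S}

/-- The matrix `E[u uᵗ]` of a random vector. -/
def secondMoment {ι : Type*} (P : Measure S) (u : S → ι → ℝ) : Matrix ι ι ℝ :=
  Matrix.of fun c d => ∫ ω, u ω c * u ω d ∂P

theorem memLp_mulVec {ι κ : Type*} [Fintype ι] [Fintype κ] (D : Matrix κ ι ℝ) {u : S → ι → ℝ}
    (hu : MemLp u 2 P) : MemLp (fun ω => D *ᵥ u ω) 2 P := by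
  rw [memLp_pi_iff] at hu ⊢
  exact fun a => memLp_finsetSum _ fun c _ => (hu c).const_mul (D a c)

theorem integrable_apply_mul_apply {ι κ : Type*} [Fintype ι] [Fintype κ] {u : S → ι → ℝ}
    {v : S → κ → ℝ} (hu : MemLp u 2 P) (hv : MemLp v 2 P) (c : ι) (d : κ) :
    Integrable (fun ω => u ω c * v ω d) P :=
  (hu.eval c).integrable_mul (hv.eval d)

theorem mul_secondMoment_mul_transpose {ι κ : Type*} [Fintype ι] (D : Matrix κ ι ℝ)
    {u : S → ι → ℝ} (hu : MemLp u 2 P) :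
    D * secondMoment P u * Dᵀ = secondMoment P fun ω => D *ᵥ u ω := by
  ext a b
  have hInt := integrable_apply_mul_apply hu hu
  have hexp : ∀ ω, (D *ᵥ u ω) a * (D *ᵥ u ω) b =
      ∑ d, ∑ c, D a c * D b d * (u ω c * u ω d) := fun ω => by
    simp only [Matrix.mulVec, dotProduct, Finset.sum_mul_sum]
    rw [Finset.sum_comm]
    exact Finset.sum_congr rfl fun d _ => Finset.sum_congr rfl fun c _ => by ring
  simp only [secondMoment, Matrix.of_apply, hexp, Matrix.mul_apply, Matrix.transpose_apply]
  rw [integral_finsetSum _ fun d _ => integrable_finsetSum _ fun c _ => (hInt c d).const_mul _]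
  refine Finset.sum_congr rfl fun d _ => ?_
  rw [integral_finsetSum _ fun c _ => (hInt c d).const_mul _, Finset.sum_mul]
  refine Finset.sum_congr rfl fun c _ => ?_
  rw [integral_const_mul]
  ring

theorem secondMoment_posSemidef {ι : Type*} [Fintype ι] {u : S → ι → ℝ} (hu : MemLp u 2 P) :
    (secondMoment P u).PosSemidef := by
  refine .of_dotProduct_mulVec_nonneg ?_ fun x => ?_
  · ext c d
    simp only [secondMoment, Matrix.conjTranspose_apply, Matrix.of_apply, star_trivial, mul_comm]
  -- Taking `x` as a one-row matrix exhibits the quadratic form as `E[(x · u)²]`.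
  · have h := mul_secondMoment_mul_transpose (Matrix.replicateRow Unit x) hu
    have h' := congrFun (congrFun h ()) ()
    have h2 : star x ⬝ᵥ (secondMoment P u *ᵥ x) =
        (Matrix.replicateRow Unit x * secondMoment P u * (Matrix.replicateRow Unit x)ᵀ) () () := by
      rw [Matrix.mul_assoc]
      simp [Matrix.mul_apply, dotProduct, Matrix.mulVec]
    rw [h2, h']
    exact integral_nonneg fun ω => mul_self_nonneg _

theorem ae_eq_zero_of_secondMoment_eq_zero {ι : Type*} [Fintype ι] {u : S → ι → ℝ}
    (hu : MemLp u 2 P) (h : secondMoment P u = 0) : ∀ᵐ ω ∂P, u ω = 0 := by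
  have : ∀ c, ∀ᵐ ω ∂P, u ω c = 0 := fun c => by
    have hc : ∫ ω, u ω c * u ω c ∂P = 0 := congrFun (congrFun h c) c
    rw [integral_eq_zero_iff_of_nonneg (fun ω => mul_self_nonneg _)
      (integrable_apply_mul_apply hu hu c c)] at hc
    exact hc.mono fun ω hω => mul_self_eq_zero.1 hω
  exact (ae_all_iff.2 this).mono fun ω hω => funext hω

theorem crossCov_congr {a b : ℕ} {f f' : S → Fin a → ℝ} {g g' : S → Fin b → ℝ} (hf : f =ᵐ[P] f')
    (hg : g =ᵐ[P] g') : crossCov P f g = crossCov P f' g' := by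
  have hf' : ∀ i, (fun ω => f ω i) =ᵐ[P] fun ω => f' ω i := fun i =>
    hf.mono fun ω h => congrFun h i
  have hg' : ∀ i, (fun ω => g ω i) =ᵐ[P] fun ω => g' ω i := fun i =>
    hg.mono fun ω h => congrFun h i
  ext i j
  simp only [crossCov, Matrix.of_apply, covariance, integral_congr_ae (hf' i),
    integral_congr_ae (hg' j)]
  refine integral_congr_ae ?_
  filter_upwards [hf' i, hg' j] with ω h1 h2
  rw [h1, h2]

theorem crossCov_self_posSemidef [IsFiniteMeasure P] {a : ℕ} {f : S → Fin a → ℝ}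
    (hf : MemLp f 2 P) : (crossCov P f f).PosSemidef :=
  secondMoment_posSemidef (u := fun ω => f ω - fun i => ∫ ω, f ω i ∂P) (hf.sub (memLp_const _))

end SecondMoments

/-! ### The population step-two model -/

section Regression

variable {S : Type*} {p r l m : ℕ}

/-- `Y` follows the step-two model with parameter `θ` and covariates `Z`, `F` as far as second
moments are concerned, and the residual is orthogonal to all functions measurable with respect to
a σ-algebra `𝓜` which contains the information in the covariates. -/
structure IsRegression (𝓜 : MeasurableSpace S) {mS : MeasurableSpace S} (P : Measure S) (Z : S → Fin r → ℝ)
    (F : S → Fin l → ℝ) (Y : S → Fin m → ℝ) (θ : StepTwoParam p r l m) : Prop where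
  stronglyMeasurable_covariate : StronglyMeasurable[𝓜] Z
  stronglyMeasurable_prediction : StronglyMeasurable[𝓜] F
  memLp_covariate : MemLp Z 2 P
  memLp_prediction : MemLp F 2 P
  memLp_outcome : MemLp Y 2 P
  orthogonal : ∀ g : S → ℝ, StronglyMeasurable[𝓜] g → MemLp g 2 P → ∀ a,
    ∫ ω, (Y ω - θ.mean (Z ω) (F ω)) a * g ω ∂P = 0
  secondMoment_eq : secondMoment P (fun ω => Y ω - θ.mean (Z ω) (F ω)) = θ.resCov

variable {𝓜 mS : MeasurableSpace S} {P : Measure S} {Z : S → Fin r → ℝ}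
  {F : S → Fin l → ℝ} {Y : S → Fin m → ℝ} {θ : StepTwoParam p r l m}

theorem StepTwoParam.continuous_mean (θ : StepTwoParam p r l m) :
    Continuous fun w : (Fin r → ℝ) × (Fin l → ℝ) => θ.mean w.1 w.2 := by
  have h : ∀ {i j : ℕ} (D : Matrix (Fin i) (Fin j) ℝ), Continuous fun v => D *ᵥ v := fun D =>
    continuous_const.matrix_mulVec continuous_id
  have h1 : Continuous fun w : (Fin r → ℝ) × (Fin l → ℝ) => θ.alpha + θ.B *ᵥ w.2 + θ.Gamma *ᵥ w.1 :=
    (continuous_const.add ((h _).comp continuous_snd)).add ((h _).comp continuous_fst)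
  exact (continuous_const.add ((h _).comp h1)).add ((h _).comp continuous_fst)

theorem IsRegression.stronglyMeasurable_mean (h : IsRegression 𝓜 P Z F Y θ)
    (θ' : StepTwoParam p r l m) : StronglyMeasurable[𝓜] fun ω => θ'.mean (Z ω) (F ω) := by
  have hZF : StronglyMeasurable[𝓜] fun ω => (Z ω, F ω) :=
    StronglyMeasurable.prodMk h.stronglyMeasurable_covariate h.stronglyMeasurable_prediction
  have hmean := Continuous.comp_stronglyMeasurable θ'.continuous_mean hZF
  exact hmean

variable [IsProbabilityMeasure P]

theorem IsRegression.memLp_mean (h : IsRegression 𝓜 P Z F Y θ) (θ' : StepTwoParam p r l m) :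
    MemLp (fun ω => θ'.mean (Z ω) (F ω)) 2 P := by
  have h1 : MemLp (fun ω => θ'.alpha + θ'.B *ᵥ F ω + θ'.Gamma *ᵥ Z ω) 2 P :=
    ((memLp_const θ'.alpha).add (memLp_mulVec θ'.B h.memLp_prediction)).add
      (memLp_mulVec θ'.Gamma h.memLp_covariate)
  have h2 : MemLp (fun ω => θ'.nu + θ'.Lambda *ᵥ (θ'.alpha + θ'.B *ᵥ F ω + θ'.Gamma *ᵥ Z ω)) 2 P :=
    (memLp_const θ'.nu).add (memLp_mulVec θ'.Lambda h1)
  exact h2.add (memLp_mulVec θ'.K h.memLp_covariate)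

theorem IsRegression.memLp_obsVec (h : IsRegression 𝓜 P Z F Y θ) :
    MemLp (fun ω => obsVec (Z ω) (F ω) (Y ω)) 2 P := by
  rw [memLp_pi_iff]
  rintro (c | c | c | c)
  · exact memLp_const 1
  · exact h.memLp_covariate.eval c
  · exact h.memLp_prediction.eval c
  · exact h.memLp_outcome.eval c

/-- The second moments of the residual at a parameter exceed those at `θ` by the second moments
of the difference of the modelled means. -/
theorem IsRegression.residual_secondMoment (h : IsRegression 𝓜 P Z F Y θ)
    (θ' : StepTwoParam p r l m) :
    θ'.residualMatrix * secondMoment P (fun ω => obsVec (Z ω) (F ω) (Y ω)) * θ'.residualMatrixᵀ =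
      θ.resCov + secondMoment P fun ω => θ.mean (Z ω) (F ω) - θ'.mean (Z ω) (F ω) := by
  rw [mul_secondMoment_mul_transpose _ h.memLp_obsVec, ← h.secondMoment_eq]
  simp_rw [← StepTwoParam.sub_mean_eq]
  set e := fun ω => Y ω - θ.mean (Z ω) (F ω) with he
  set d := fun ω => θ.mean (Z ω) (F ω) - θ'.mean (Z ω) (F ω) with hd
  have hemem : MemLp e 2 P := h.memLp_outcome.sub (h.memLp_mean θ)
  have hdmem : MemLp d 2 P := (h.memLp_mean θ).sub (h.memLp_mean θ')
  have hdmeas : StronglyMeasurable[𝓜] d :=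
    (h.stronglyMeasurable_mean θ).sub (h.stronglyMeasurable_mean θ')
  -- The difference of two modelled means is a function of `Z` and `F`, so the cross terms vanish.
  have horth : ∀ a b, ∫ ω, e ω a * d ω b ∂P = 0 := fun a b =>
    h.orthogonal (fun ω => d ω b)
      ((continuous_apply b).comp_stronglyMeasurable hdmeas) (hdmem.eval b) a
  have hsum : ∀ ω, Y ω - θ'.mean (Z ω) (F ω) = e ω + d ω := fun ω => by simp [he, hd]
  have hee := integrable_apply_mul_apply hemem hemem
  have hed := integrable_apply_mul_apply hemem hdmem
  have hdd := integrable_apply_mul_apply hdmem hdmem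
  ext a b
  simp only [secondMoment, Matrix.of_apply, Matrix.add_apply, hsum, Pi.add_apply]
  have hexp : ∀ ω, (e ω a + d ω a) * (e ω b + d ω b) =
      (e ω a * e ω b + e ω a * d ω b) + (e ω b * d ω a + d ω a * d ω b) := fun ω => by ring
  simp_rw [hexp]
  rw [integral_add ((hee a b).fun_add (hed a b)) ((hed b a).fun_add (hdd a b)),
    integral_add (hee a b) (hed a b), integral_add (hed b a) (hdd a b), horth, horth]
  ring

/-- A parameter which models the same mean and the same residual covariance matrix as `θ`
reproduces the first two moments. -/
theorem IsRegression.inducesMoments (h : IsRegression 𝓜 P Z F Y θ) {θ' : StepTwoParam p r l m}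
    (hmean : (fun ω => θ'.mean (Z ω) (F ω)) =ᵐ[P] fun ω => θ.mean (Z ω) (F ω))
    (hcov : θ'.resCov = θ.resCov) : InducesMoments P Z F Y θ' := by
  set μ := fun ω => θ.mean (Z ω) (F ω) with hμ
  set e := fun ω => Y ω - μ ω with he
  have hYe : Y = fun ω => μ ω + e ω := by simp [he]
  have hμmem : MemLp μ 2 P := h.memLp_mean θ
  have hemem : MemLp e 2 P := h.memLp_outcome.sub hμmem
  have hμmeas : StronglyMeasurable[𝓜] μ := h.stronglyMeasurable_mean θ
  have hezero : ∀ a, ∫ ω, e ω a ∂P = 0 := fun a => by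
    have := h.orthogonal (fun _ => 1) stronglyMeasurable_const (memLp_const 1) a
    simpa only [mul_one] using this
  have hcov0 : ∀ g : S → ℝ, StronglyMeasurable[𝓜] g → MemLp g 2 P → ∀ a,
      cov[g, fun ω => e ω a; P] = 0 := fun g hg hg2 a => by
    rw [covariance_eq_sub hg2 (hemem.eval a), hezero, mul_zero, sub_zero]
    refine Eq.trans (integral_congr_ae (Eventually.of_forall fun ω => ?_))
      (h.orthogonal g hg hg2 a)
    exact mul_comm _ _
  have hcross : ∀ {k : ℕ} (G : S → Fin k → ℝ), StronglyMeasurable[𝓜] G → MemLp G 2 P →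
      crossCov P G Y = crossCov P G μ := fun G hG hG2 => by
    ext i j
    simp only [crossCov, Matrix.of_apply]
    have : (fun ω => Y ω j) = (fun ω => μ ω j) + fun ω => e ω j := by rw [hYe]; rfl
    rw [this, covariance_add_right (hG2.eval i) (hμmem.eval j) (hemem.eval j),
      hcov0 (fun ω => G ω i) ((continuous_apply i).comp_stronglyMeasurable hG) (hG2.eval i),
      add_zero]
  have hIntMean : ∀ j, ∫ ω, θ'.mean (Z ω) (F ω) j ∂P = ∫ ω, μ ω j ∂P := fun j =>
    integral_congr_ae (hmean.mono fun ω hω => congrFun hω j)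
  refine ⟨fun j => ?_, ?_, ?_, ?_⟩
  · have hsplit : ∀ ω, Y ω j = μ ω j + e ω j := fun ω => by rw [hYe]; rfl
    simp_rw [hsplit]
    rw [integral_add ((hμmem.eval j).integrable one_le_two)
      ((hemem.eval j).integrable one_le_two), hezero, add_zero, hIntMean]
  · rw [hcross Z h.stronglyMeasurable_covariate h.memLp_covariate,
      crossCov_congr (f' := Z) EventuallyEq.rfl hmean]
  · rw [hcross F h.stronglyMeasurable_prediction h.memLp_prediction,
      crossCov_congr (f' := F) EventuallyEq.rfl hmean]
  · rw [crossCov_congr hmean hmean, hcov, ← h.secondMoment_eq]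
    ext i j
    simp only [crossCov, Matrix.of_apply, Matrix.add_apply, secondMoment]
    have hdec : ∀ k, (fun ω => Y ω k) = (fun ω => μ ω k) + fun ω => e ω k := fun k => by
      rw [hYe]; rfl
    have hμk : ∀ k, StronglyMeasurable[𝓜] fun ω => μ ω k := fun k =>
      (continuous_apply k).comp_stronglyMeasurable hμmeas
    rw [hdec i, hdec j, covariance_add_left (hμmem.eval i) (hemem.eval i)
      ((hμmem.eval j).add (hemem.eval j)),
      covariance_add_right (hμmem.eval i) (hμmem.eval j) (hemem.eval j),
      covariance_add_right (hemem.eval i) (hμmem.eval j) (hemem.eval j),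
      hcov0 _ (hμk i) (hμmem.eval i), covariance_comm (fun ω => e ω i) (fun ω => μ ω j),
      hcov0 _ (hμk j) (hμmem.eval j), covariance_eq_sub (hemem.eval i) (hemem.eval j), hezero,
      zero_mul, sub_zero, add_zero, zero_add]
    rfl

end Regression

/-! ### Auxiliary facts on product measures and conditional expectations -/

section Auxiliary

theorem measurePreserving_leftComm {α β γ : Type*} [MeasurableSpace α] [MeasurableSpace β]
    [MeasurableSpace γ] (μ : Measure α) (ν : Measure β) (ρ : Measure γ) [SFinite μ] [SFinite ν]
    [SFinite ρ] :
    MeasurePreserving (fun w : α × β × γ => (w.2.1, w.1, w.2.2)) (μ.prod (ν.prod ρ))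
      (ν.prod (μ.prod ρ)) :=
  (measurePreserving_prodAssoc ν μ ρ).comp
    (((Measure.measurePreserving_swap (μ := μ) (ν := ν)).prod (MeasurePreserving.id ρ)).comp
      ((measurePreserving_prodAssoc μ ν ρ).symm MeasurableEquiv.prodAssoc))

/-- Conditional expectations of functions of a random variable `T`, given a function of `T`. -/
theorem condExp_comp_ae_eq {S W W' G : Type*} [MeasurableSpace S] [MeasurableSpace W]
    [mW' : MeasurableSpace W'] [NormedAddCommGroup G] [NormedSpace ℝ G] [CompleteSpace G]
    {P : Measure S} [IsFiniteMeasure P] {T : S → W} (hT : Measurable T) {O : W → W'}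
    (hO : Measurable O) {f : W → G} (hf : Integrable f (P.map T)) :
    (fun ω => ((P.map T)[f | mW'.comap O]) (T ω)) =ᵐ[P]
      P[fun ω => f (T ω) | mW'.comap fun ω => O (T ω)] := by
  have hle : mW'.comap (fun ω => O (T ω)) ≤ (inferInstance : MeasurableSpace S) :=
    (hO.comp hT).comap_le
  have hcint : Integrable ((P.map T)[f | mW'.comap O]) (P.map T) := integrable_condExp
  refine ae_eq_condExp_of_forall_setIntegral_eq hle (hf.comp_measurable hT)
    (fun s _ _ => (hcint.comp_measurable hT).integrableOn) ?_ ?_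
  · rintro s ⟨s', hs', rfl⟩ -
    have hs : MeasurableSet (O ⁻¹' s') := hO hs'
    have h1 := setIntegral_map hs hcint.aestronglyMeasurable hT.aemeasurable
    have h2 := setIntegral_map hs hf.aestronglyMeasurable hT.aemeasurable
    have h3 := setIntegral_condExp hO.comap_le hf (s := O ⁻¹' s') ⟨s', hs', rfl⟩
    rw [h1, h2] at h3
    exact h3
  · refine StronglyMeasurable.aestronglyMeasurable ?_
    have h1 : StronglyMeasurable[mW'.comap O] ((P.map T)[f | mW'.comap O]) :=
      stronglyMeasurable_condExp
    refine h1.comp_measurable (g := T) ?_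
    rintro _ ⟨s', hs', rfl⟩
    exact ⟨s', hs', rfl⟩

/-- Pull `g` out, `E[f g | 𝓜] = E[f | 𝓜] g`, and integrate. -/
theorem integral_sub_condExp_mul {S : Type*} {𝓜 mS : MeasurableSpace S} {P : Measure S}
    [IsFiniteMeasure P] (h𝓜 : 𝓜 ≤ mS) {f g : S → ℝ} (hf : MemLp f 2 P) (hg : MemLp g 2 P)
    (hgm : StronglyMeasurable[𝓜] g) : ∫ ω, (f ω - (P[f | 𝓜]) ω) * g ω ∂P = 0 := by
  have hfg : Integrable (f * g) P := hf.integrable_mul hg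
  have hpull := condExp_mul_of_stronglyMeasurable_right hgm hfg (hf.integrable one_le_two)
  have hInt : Integrable (P[f | 𝓜] * g) P := integrable_condExp.congr hpull
  have h1 : ∫ ω, (P[f | 𝓜] * g) ω ∂P = ∫ ω, (f * g) ω ∂P := by
    rw [← integral_congr_ae hpull, integral_condExp h𝓜]
  have h2 : ∀ ω, (f ω - (P[f | 𝓜]) ω) * g ω = (f * g) ω - (P[f | 𝓜] * g) ω := fun ω => by
    simp only [Pi.mul_apply]; ring
  simp_rw [h2]
  rw [integral_sub hfg hInt, h1, sub_self]

theorem condExp_apply_ae_eq {S : Type*} {𝓜 mS : MeasurableSpace S} {P : Measure S} {k : ℕ}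
    {f : S → Fin k → ℝ} (hf : Integrable f P) (j : Fin k) :
    (fun ω => (P[f | 𝓜]) ω j) =ᵐ[P] P[fun ω => f ω j | 𝓜] :=
  (ContinuousLinearMap.proj (R := ℝ) (φ := fun _ : Fin k => ℝ) j).comp_condExp_comm hf

/-- A centred random variable is orthogonal to the square integrable functions of an independent
one. -/
theorem integral_mul_eq_zero_of_indepFun {S W W' : Type*} [MeasurableSpace S] [MeasurableSpace W]
    [mW' : MeasurableSpace W'] {P : Measure S} {U : S → W} {T : S → W'} (h : IndepFun U T P)
    (hU : Measurable U) (hT : Measurable T) {f : W → ℝ} (hf : Measurable f)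
    (h0 : ∫ ω, f (U ω) ∂P = 0) {g : S → ℝ} (hg : Measurable[mW'.comap T] g) :
    ∫ ω, f (U ω) * g ω ∂P = 0 := by
  have hind : IndepFun (fun ω => f (U ω)) g P :=
    indep_of_indep_of_le_right (h.comp hf measurable_id) hg.comap_le
  rw [hind.integral_fun_mul_eq_mul_integral (hf.comp hU).aestronglyMeasurable
    (hg.mono hT.comap_le le_rfl).aestronglyMeasurable, h0, zero_mul]

end Auxiliary

/-! ### Consequences of the non-linear SEM -/

section SEM

variable {p q r l h m : ℕ}

theorem continuous_matrix_mulVec {i j : ℕ} (D : Matrix (Fin i) (Fin j) ℝ) :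
    Continuous fun v => D *ᵥ v :=
  continuous_const.matrix_mulVec continuous_id

theorem StepOneParam.continuous_latent (θ : StepOneParam q r h) : Continuous θ.latent := by
  have h1 : Continuous fun w : (Fin r → ℝ) × (Fin q → ℝ) × (Fin h → ℝ) =>
      θ.alpha + θ.Gamma *ᵥ w.1 + w.2.1 :=
    (continuous_const.add ((continuous_matrix_mulVec _).comp continuous_fst)).add
      (continuous_fst.comp continuous_snd)
  exact (continuous_matrix_mulVec _).comp h1

theorem StepOneParam.continuous_obs (θ : StepOneParam q r h) : Continuous θ.obs := by
  have h1 : Continuous fun w : (Fin r → ℝ) × (Fin q → ℝ) × (Fin h → ℝ) =>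
      θ.nu + θ.Lambda *ᵥ θ.latent w + θ.K *ᵥ w.1 + w.2.2 :=
    ((continuous_const.add ((continuous_matrix_mulVec _).comp θ.continuous_latent)).add
      ((continuous_matrix_mulVec _).comp continuous_fst)).add
      (continuous_snd.comp continuous_snd)
  exact continuous_fst.prodMk h1

/-- Provides the dense sequences behind the uniform law of large numbers. -/
instance : SecondCountableTopology (StepOneParam q r h) :=
  have _h : ∀ i j : ℕ, SecondCountableTopology (Matrix (Fin i) (Fin j) ℝ) := fun i j =>
    inferInstanceAs (SecondCountableTopology (Fin i → Fin j → ℝ))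
  TopologicalSpace.secondCountableTopology_induced _ _ StepOneParam.toProd

theorem IsResidualLaw.integral_apply_eq_zero {S : Type*} [MeasurableSpace S] {P : Measure S}
    {d : ℕ} {μ : Measure (Fin d → ℝ)} {C : Matrix (Fin d) (Fin d) ℝ} (hμ : IsResidualLaw μ C)
    {U : S → Fin d → ℝ} (hU : Measurable U) (hlaw : P.map U = μ) (i : Fin d) :
    ∫ ω, U ω i ∂P = 0 := by
  rw [← hμ.mean_eq_zero i, ← hlaw, integral_map hU.aemeasurable
    (measurable_pi_apply i).aestronglyMeasurable]

theorem IsResidualLaw.secondMoment_apply {S : Type*} [MeasurableSpace S] {P : Measure S}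
    {d : ℕ} {μ : Measure (Fin d → ℝ)} {C : Matrix (Fin d) (Fin d) ℝ} (hμ : IsResidualLaw μ C)
    {U : S → Fin d → ℝ} (hU : Measurable U) (hlaw : P.map U = μ) (i j : Fin d) :
    ∫ ω, U ω i * U ω j ∂P = C i j := by
  have hm : Measurable fun x : Fin d → ℝ => x i * x j := by fun_prop
  rw [← hμ.covariance_eq i j, ← hlaw, integral_map hU.aemeasurable hm.aestronglyMeasurable]

theorem memLp_of_map_eq {S : Type*} [MeasurableSpace S] {P : Measure S} {d : ℕ}
    {μ : Measure (Fin d → ℝ)} (hμ : MemLp id 2 μ) {U : S → Fin d → ℝ} (hU : Measurable U)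
    (hlaw : P.map U = μ) : MemLp U 2 P := by
  rw [← hlaw] at hμ
  exact (memLp_map_measure_iff hμ.1 hU.aemeasurable).1 hμ

variable {S : Type*} [MeasurableSpace S] {P : Measure S}
  {φ : (Fin q → ℝ) → Fin l → ℝ} {L : Matrix (Fin q) (Fin q) ℝ → Measure (Fin q → ℝ)}
  {E : Matrix (Fin h) (Fin h) ℝ → Measure (Fin h → ℝ)} {μZ : Measure (Fin r → ℝ)}
  {μζ : Measure (Fin p → ℝ)} {με : Measure (Fin m → ℝ)} {Θ₁ : Set (StepOneParam q r h)}
  {θ₁ : StepOneParam q r h} {θ₂ : StepTwoParam p r l m} {Z : ℕ → S → Fin r → ℝ}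
  {ξ ζ' : ℕ → S → Fin q → ℝ} {η ζ : ℕ → S → Fin p → ℝ} {X ε' : ℕ → S → Fin h → ℝ}
  {Y ε : ℕ → S → Fin m → ℝ}

theorem IsStepOneSpace.isProbabilityMeasure_law (hΘ₁ : IsStepOneSpace L E Θ₁)
    [IsProbabilityMeasure μZ] {θ : StepOneParam q r h} (hθ : θ ∈ Θ₁) :
    IsProbabilityMeasure (θ.law L E μZ) := by
  have := (hΘ₁.latent_residual θ hθ).isProbabilityMeasure
  have := (hΘ₁.error_residual θ hθ).isProbabilityMeasure
  unfold StepOneParam.law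
  infer_instance

theorem IsNonlinearSEM.latent_eq (hsem : IsNonlinearSEM P φ L E μZ μζ με θ₁ θ₂ Z ξ ζ' η ζ X ε' Y ε)
    (hB : IsUnit (1 - θ₁.B)) (i : ℕ) (ω : S) :
    ξ i ω = θ₁.latent (Z i ω, ζ' i ω, ε' i ω) := by
  have h1 : (1 - θ₁.B) *ᵥ ξ i ω = θ₁.alpha + θ₁.Gamma *ᵥ Z i ω + ζ' i ω := by
    rw [Matrix.sub_mulVec, Matrix.one_mulVec, sub_eq_iff_eq_add]
    nth_rewrite 1 [hsem.structural_predictor i ω]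
    abel
  rw [StepOneParam.latent, ← h1, Matrix.mulVec_mulVec,
    Matrix.nonsing_inv_mul _ ((Matrix.isUnit_iff_isUnit_det _).1 hB), Matrix.one_mulVec]

theorem IsNonlinearSEM.obs_eq (hsem : IsNonlinearSEM P φ L E μZ μζ με θ₁ θ₂ Z ξ ζ' η ζ X ε' Y ε)
    (hB : IsUnit (1 - θ₁.B)) (i : ℕ) (ω : S) :
    θ₁.obs (Z i ω, ζ' i ω, ε' i ω) = (Z i ω, X i ω) := by
  rw [hsem.measurement_predictor, hsem.latent_eq hB]
  rfl

/-- Moving `ζ` and `ε` to the front of the product displays their independence of the step-one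
variables `(Z, ζ', ε')`. -/
theorem IsNonlinearSEM.map_exogenous
    (hsem : IsNonlinearSEM P φ L E μZ μζ με θ₁ θ₂ Z ξ ζ' η ζ X ε' Y ε)
    (hΘ₁ : IsStepOneSpace L E Θ₁) (hθ₁ : θ₁ ∈ Θ₁) (i : ℕ) :
    P.map (fun ω => (ζ i ω, ε i ω, Z i ω, ζ' i ω, ε' i ω)) =
      μζ.prod (με.prod (θ₁.law L E μZ)) := by
  have := hsem.covariate_law.1
  have := hsem.residual_outcome.isProbabilityMeasure
  have := hsem.error_outcome.isProbabilityMeasure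
  have := (hΘ₁.latent_residual θ₁ hθ₁).isProbabilityMeasure
  have := (hΘ₁.error_residual θ₁ hθ₁).isProbabilityMeasure
  obtain ⟨hζ, hζ', hε, hε'⟩ := hsem.measurable_residual i
  have hZ := hsem.measurable_covariate i
  have h1 := measurePreserving_leftComm μZ μζ ((L θ₁.Psi).prod (με.prod (E θ₁.Omega)))
  have h2 := (MeasurePreserving.id μζ).prod ((MeasurePreserving.id μZ).prod
    (measurePreserving_leftComm (L θ₁.Psi) με (E θ₁.Omega)))
  have h3 := (MeasurePreserving.id μζ).prod
    (measurePreserving_leftComm μZ με ((L θ₁.Psi).prod (E θ₁.Omega)))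
  have h4 := (h3.comp h2).comp h1
  rw [StepOneParam.law, ← h4.map_eq, ← hsem.law_eq i, Measure.map_map h4.measurable
    (hZ.prodMk (hζ.prodMk (hζ'.prodMk (hε.prodMk hε'))))]
  rfl

theorem IsNonlinearSEM.isIID
    (hsem : IsNonlinearSEM P φ L E μZ μζ με θ₁ θ₂ Z ξ ζ' η ζ X ε' Y ε) :
    IsIID P (μZ.prod (μζ.prod ((L θ₁.Psi).prod (με.prod (E θ₁.Omega)))))
      (fun i ω => (Z i ω, ζ i ω, ζ' i ω, ε i ω, ε' i ω)) where
  measurable i := by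
    obtain ⟨hζ, hζ', hε, hε'⟩ := hsem.measurable_residual i
    exact (hsem.measurable_covariate i).prodMk (hζ.prodMk (hζ'.prodMk (hε.prodMk hε')))
  indep _ _ hij := hsem.independent.indepFun hij
  map_eq := hsem.law_eq

theorem IsNonlinearSEM.map_stepOne
    (hsem : IsNonlinearSEM P φ L E μZ μζ με θ₁ θ₂ Z ξ ζ' η ζ X ε' Y ε)
    (hΘ₁ : IsStepOneSpace L E Θ₁) (hθ₁ : θ₁ ∈ Θ₁) (i : ℕ) :
    P.map (fun ω => (Z i ω, ζ' i ω, ε' i ω)) = θ₁.law L E μZ := by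
  have := hsem.covariate_law.1
  have := hsem.residual_outcome.isProbabilityMeasure
  have := hsem.error_outcome.isProbabilityMeasure
  have := hΘ₁.isProbabilityMeasure_law (μZ := μZ) hθ₁
  obtain ⟨hζ, hζ', hε, hε'⟩ := hsem.measurable_residual i
  have hT := (hsem.measurable_covariate i).prodMk (hζ'.prodMk hε')
  have h1 := congrArg (fun ν => (ν.map Prod.snd).map Prod.snd) (hsem.map_exogenous hΘ₁ hθ₁ i)
  simp only [Measure.map_snd_prod, measure_univ, one_smul] at h1
  rw [← h1, Measure.map_map measurable_snd (hζ.prodMk (hε.prodMk hT)),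
    Measure.map_map measurable_snd (measurable_snd.comp (hζ.prodMk (hε.prodMk hT)))]
  rfl

/-- The observations of step one are independent with the law given by the model. -/
theorem IsNonlinearSEM.isIID_stepOne
    (hsem : IsNonlinearSEM P φ L E μZ μζ με θ₁ θ₂ Z ξ ζ' η ζ X ε' Y ε)
    (hΘ₁ : IsStepOneSpace L E Θ₁) (hθ₁ : θ₁ ∈ Θ₁) :
    IsIID P (θ₁.obsLaw L E μZ) (fun i ω => (Z i ω, X i ω)) := by
  have hg : Measurable fun d : (Fin r → ℝ) × (Fin p → ℝ) × (Fin q → ℝ) × (Fin m → ℝ) ×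
      (Fin h → ℝ) => (d.1, d.2.2.1, d.2.2.2.2) := by fun_prop
  have h1 := (hsem.isIID.comp hg).comp θ₁.continuous_obs.measurable
  have hB := hΘ₁.isUnit θ₁ hθ₁
  simp only [hsem.obs_eq hB] at h1
  convert h1 using 1
  rw [StepOneParam.obsLaw, ← hsem.map_stepOne hΘ₁ hθ₁ 0, ← hsem.law_eq 0,
    Measure.map_map hg (hsem.isIID.measurable 0)]
  rfl

/-- The observations of step two are independent and identically distributed. -/
theorem IsNonlinearSEM.isIID_stepTwo
    (hsem : IsNonlinearSEM P φ L E μZ μζ με θ₁ θ₂ Z ξ ζ' η ζ X ε' Y ε)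
    (hB : IsUnit (1 - θ₁.B)) :
    IsIID P (P.map fun ω => ((Z 0 ω, X 0 ω), Y 0 ω)) (fun i ω => ((Z i ω, X i ω), Y i ω)) := by
  let g : (Fin r → ℝ) × (Fin p → ℝ) × (Fin q → ℝ) × (Fin m → ℝ) × (Fin h → ℝ) →
      ((Fin r → ℝ) × (Fin h → ℝ)) × (Fin m → ℝ) := fun d =>
    (θ₁.obs (d.1, d.2.2.1, d.2.2.2.2), θ₂.nu + θ₂.Lambda *ᵥ (θ₂.alpha +
      θ₂.B *ᵥ φ (θ₁.latent (d.1, d.2.2.1, d.2.2.2.2)) + θ₂.Gamma *ᵥ d.1 + d.2.1) +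
      θ₂.K *ᵥ d.1 + d.2.2.2.1)
  have hmul : ∀ {i j : ℕ} (D : Matrix (Fin i) (Fin j) ℝ), Measurable fun v => D *ᵥ v := fun D =>
    (continuous_matrix_mulVec D).measurable
  have hT : Measurable fun d : (Fin r → ℝ) × (Fin p → ℝ) × (Fin q → ℝ) × (Fin m → ℝ) ×
      (Fin h → ℝ) => (d.1, d.2.2.1, d.2.2.2.2) := by fun_prop
  have hφ : Measurable fun d : (Fin r → ℝ) × (Fin p → ℝ) × (Fin q → ℝ) × (Fin m → ℝ) ×
      (Fin h → ℝ) => φ (θ₁.latent (d.1, d.2.2.1, d.2.2.2.2)) :=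
    hsem.measurable_phi.comp (θ₁.continuous_latent.measurable.comp hT)
  have hη : Measurable fun d : (Fin r → ℝ) × (Fin p → ℝ) × (Fin q → ℝ) × (Fin m → ℝ) ×
      (Fin h → ℝ) => θ₂.alpha + θ₂.B *ᵥ φ (θ₁.latent (d.1, d.2.2.1, d.2.2.2.2)) +
        θ₂.Gamma *ᵥ d.1 + d.2.1 :=
    ((((hmul θ₂.B).comp hφ).const_add _).add ((hmul θ₂.Gamma).comp measurable_fst)).add
      (measurable_fst.comp measurable_snd)
  have hy : Measurable fun d : (Fin r → ℝ) × (Fin p → ℝ) × (Fin q → ℝ) × (Fin m → ℝ) ×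
      (Fin h → ℝ) => θ₂.nu + θ₂.Lambda *ᵥ (θ₂.alpha +
      θ₂.B *ᵥ φ (θ₁.latent (d.1, d.2.2.1, d.2.2.2.2)) + θ₂.Gamma *ᵥ d.1 + d.2.1) +
      θ₂.K *ᵥ d.1 + d.2.2.2.1 :=
    ((((hmul θ₂.Lambda).comp hη).const_add _).add ((hmul θ₂.K).comp measurable_fst)).add
      (by fun_prop)
  have hg : Measurable g := (θ₁.continuous_obs.measurable.comp hT).prodMk hy
  have hV : ∀ i ω, g (Z i ω, ζ i ω, ζ' i ω, ε i ω, ε' i ω) = ((Z i ω, X i ω), Y i ω) :=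
    fun i ω => by
      rw [hsem.measurement_outcome, hsem.structural_outcome, hsem.latent_eq hB]
      simp only [g, hsem.obs_eq hB]
  have h1 := hsem.isIID.comp hg
  simp only [hV] at h1
  rwa [← h1.map_eq 0] at h1

end SEM

/-! ### The exact linear model after replacing `φ(ξ)` by its conditional mean -/

section PopulationModel

variable {p q r l h m : ℕ}

/-- If the regressor `f` of a linear SEM is replaced by its conditional mean, the step-two model
holds with the covariance matrix of `B (f - E[f | 𝓜])` added to `Psi`. -/
theorem isRegression_condExp {S : Type*} {𝓜 mS : MeasurableSpace S} {P : Measure S}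
    [IsProbabilityMeasure P] (h𝓜 : 𝓜 ≤ mS) {θ : StepTwoParam p r l m} {Z : S → Fin r → ℝ}
    {f : S → Fin l → ℝ} {ζ : S → Fin p → ℝ} {Y ε : S → Fin m → ℝ}
    (hZm : StronglyMeasurable[𝓜] Z) (hZ : MemLp Z 2 P) (hf : MemLp f 2 P) (hζ : MemLp ζ 2 P)
    (hε : MemLp ε 2 P)
    (hY : ∀ ω, Y ω = θ.nu + θ.Lambda *ᵥ (θ.alpha + θ.B *ᵥ f ω + θ.Gamma *ᵥ Z ω + ζ ω) +
      θ.K *ᵥ Z ω + ε ω)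
    (hζ𝓜 : ∀ g : S → ℝ, StronglyMeasurable[𝓜] g → ∀ j, ∫ ω, ζ ω j * g ω ∂P = 0)
    (hε𝓜 : ∀ g : S → ℝ, StronglyMeasurable[𝓜] g → ∀ j, ∫ ω, ε ω j * g ω ∂P = 0)
    (hζf : ∀ i j, ∫ ω, ζ ω i * f ω j ∂P = 0) (hεf : ∀ i j, ∫ ω, ε ω i * f ω j ∂P = 0)
    (hζε : ∀ i j, ∫ ω, ζ ω i * ε ω j ∂P = 0) (hζζ : secondMoment P ζ = θ.Psi)
    (hεε : secondMoment P ε = θ.Omega) :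
    IsRegression 𝓜 P Z (P[f | 𝓜]) Y
      ⟨θ.toStepTwoCore, θ.Psi + θ.B * crossCov P (fun ω => f ω - (P[f | 𝓜]) ω)
          (fun ω => f ω - (P[f | 𝓜]) ω) * θ.Bᵀ⟩ := by
  have hFm : StronglyMeasurable[𝓜] (P[f | 𝓜]) := stronglyMeasurable_condExp
  have hFjm : ∀ j, StronglyMeasurable[𝓜] fun ω => (P[f | 𝓜]) ω j := fun j =>
    (continuous_apply j).comp_stronglyMeasurable hFm
  have hfint : Integrable f P := hf.integrable one_le_two
  have hF : MemLp (P[f | 𝓜]) 2 P := by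
    rw [memLp_pi_iff]
    intro j
    exact (memLp_congr_ae (condExp_apply_ae_eq hfint j)).2 ((hf.eval j).condExp one_le_two)
  set F := P[f | 𝓜] with hFdef
  have hδ : MemLp (fun ω => f ω - F ω) 2 P := hf.sub hF
  have hδorth : ∀ g : S → ℝ, StronglyMeasurable[𝓜] g → MemLp g 2 P → ∀ j,
      ∫ ω, (f ω - F ω) j * g ω ∂P = 0 := fun g hgm hg j => by
    rw [← integral_sub_condExp_mul h𝓜 (hf.eval j) hg hgm]
    refine integral_congr_ae ?_
    filter_upwards [condExp_apply_ae_eq (𝓜 := 𝓜) hfint j] with ω hω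
    rw [Pi.sub_apply, hFdef, hω]
  have hδ0 : ∀ j, ∫ ω, (f ω - F ω) j ∂P = 0 := fun j => by
    have := hδorth (fun _ => 1) stronglyMeasurable_const (memLp_const 1) j
    simpa only [mul_one] using this
  have hζδ : ∀ i j, ∫ ω, ζ ω i * (f ω - F ω) j ∂P = 0 := fun i j => by
    simp_rw [Pi.sub_apply, mul_sub]
    rw [integral_sub (integrable_apply_mul_apply hζ hf i j)
      (integrable_apply_mul_apply hζ hF i j), hζf, hζ𝓜 _ (hFjm j), sub_zero]
  have hεδ : ∀ i j, ∫ ω, ε ω i * (f ω - F ω) j ∂P = 0 := fun i j => by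
    simp_rw [Pi.sub_apply, mul_sub]
    rw [integral_sub (integrable_apply_mul_apply hε hf i j)
      (integrable_apply_mul_apply hε hF i j), hεf, hε𝓜 _ (hFjm j), sub_zero]
  -- the residual as a linear function of `(f - F, ζ, ε)`
  let t : S → Fin l ⊕ Fin p ⊕ Fin m → ℝ := fun ω => Sum.elim (f ω - F ω) (Sum.elim (ζ ω) (ε ω))
  let G : Matrix (Fin m) (Fin l ⊕ Fin p ⊕ Fin m) ℝ :=
    Matrix.fromCols (θ.Lambda * θ.B) (Matrix.fromCols θ.Lambda 1)
  have ht : MemLp t 2 P := by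
    rw [memLp_pi_iff]
    rintro (c | c | c)
    · exact hδ.eval c
    · exact hζ.eval c
    · exact hε.eval c
  have hres : ∀ ω, Y ω - θ.mean (Z ω) (F ω) = G *ᵥ t ω := fun ω => by
    simp only [G, t, Matrix.fromCols_mulVec_sumElim, hY ω, StepTwoParam.mean, Matrix.one_mulVec,
      Matrix.mulVec_add, Matrix.mulVec_sub, Matrix.mulVec_mulVec]
    abel
  -- The prediction error, `ζ` and `ε` are mutually uncorrelated. The residual `Λ (B (f - F) + ζ) +
  -- ε` therefore has covariance `Λ (B Var(f - F) Bᵗ + Psi) Λᵗ + Omega`, so the prediction error is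
  -- absorbed into `Psi`.
  have hmom : secondMoment P t = Matrix.fromBlocks
      (crossCov P (fun ω => f ω - F ω) fun ω => f ω - F ω) 0 0
      (Matrix.fromBlocks θ.Psi 0 0 θ.Omega) := by
    rw [← hζζ, ← hεε]
    ext c d
    rcases c with c | c | c <;> rcases d with d | d | d
    · simp only [secondMoment, Matrix.of_apply, Matrix.fromBlocks_apply₁₁, crossCov]
      rw [covariance_eq_sub (hδ.eval c) (hδ.eval d), hδ0, zero_mul, sub_zero]
      rfl
    · exact (integral_congr_ae (Eventually.of_forall fun ω => mul_comm _ _)).trans (hζδ d c)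
    · exact (integral_congr_ae (Eventually.of_forall fun ω => mul_comm _ _)).trans (hεδ d c)
    · exact hζδ c d
    · rfl
    · exact hζε c d
    · exact hεδ c d
    · exact (integral_congr_ae (Eventually.of_forall fun ω => mul_comm _ _)).trans (hζε d c)
    · rfl
  have hη : MemLp (fun ω => θ.alpha + θ.B *ᵥ f ω + θ.Gamma *ᵥ Z ω + ζ ω) 2 P :=
    (((memLp_const θ.alpha).add (memLp_mulVec θ.B hf)).add (memLp_mulVec θ.Gamma hZ)).add hζ
  have hY2 : MemLp Y 2 P := by
    rw [funext hY]
    exact (((memLp_const θ.nu).add (memLp_mulVec θ.Lambda hη)).add (memLp_mulVec θ.K hZ)).add hε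
  refine ⟨hZm, hFm, hZ, hF, hY2, fun g hgm hg a => ?_, ?_⟩
  -- The modelled mean does not depend on `Psi`, so `hres` applies by definition.
  · have hmean : ∀ ω, Y ω - StepTwoParam.mean ⟨θ.toStepTwoCore, θ.Psi + θ.B * crossCov P
        (fun ω => f ω - F ω) (fun ω => f ω - F ω) * θ.Bᵀ⟩ (Z ω) (F ω) = G *ᵥ t ω := hres
    simp_rw [hmean, Matrix.mulVec, dotProduct, Finset.sum_mul]
    rw [integral_finsetSum _ fun c _ => ?_]
    · refine Finset.sum_eq_zero fun c _ => ?_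
      simp_rw [mul_assoc]
      rw [integral_const_mul]
      rcases c with c | c | c
      · exact mul_eq_zero_of_right _ (hδorth g hgm hg c)
      · exact mul_eq_zero_of_right _ (hζ𝓜 g hgm c)
      · exact mul_eq_zero_of_right _ (hε𝓜 g hgm c)
    · simp_rw [mul_assoc]
      exact ((ht.eval c).integrable_mul hg).const_mul _
  · have hmean : ∀ ω, Y ω - StepTwoParam.mean ⟨θ.toStepTwoCore, θ.Psi + θ.B * crossCov P
        (fun ω => f ω - F ω) (fun ω => f ω - F ω) * θ.Bᵀ⟩ (Z ω) (F ω) = G *ᵥ t ω := hres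
    simp_rw [hmean]
    rw [← mul_secondMoment_mul_transpose G ht, hmom]
    simp only [G, Matrix.fromCols_mul_fromBlocks, Matrix.transpose_fromCols,
      Matrix.fromCols_mul_fromRows, StepTwoParam.resCov, Matrix.mul_zero, add_zero,
      zero_add, Matrix.transpose_mul, Matrix.transpose_one, Matrix.mul_one, Matrix.one_mul,
      Matrix.mul_add, Matrix.add_mul, Matrix.mul_assoc]
    abel

/-- `X`, `Z` and `ξ` are functions of `(Z, ζ', ε')`, of which `ζ` and `ε` are independent; this
yields every orthogonality relation required by `isRegression_condExp`. -/
theorem IsNonlinearSEM.isRegression {S : Type*} [MeasurableSpace S] {P : Measure S}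
    [IsProbabilityMeasure P]
    {φ : (Fin q → ℝ) → Fin l → ℝ} {L : Matrix (Fin q) (Fin q) ℝ → Measure (Fin q → ℝ)}
    {E : Matrix (Fin h) (Fin h) ℝ → Measure (Fin h → ℝ)} {μZ : Measure (Fin r → ℝ)}
    {μζ : Measure (Fin p → ℝ)} {με : Measure (Fin m → ℝ)} {Θ₁ : Set (StepOneParam q r h)}
    {θ₁ : StepOneParam q r h} {θ₂ : StepTwoParam p r l m} {Z : ℕ → S → Fin r → ℝ}
    {ξ ζ' : ℕ → S → Fin q → ℝ} {η ζ : ℕ → S → Fin p → ℝ} {X ε' : ℕ → S → Fin h → ℝ}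
    {Y ε : ℕ → S → Fin m → ℝ}
    (hsem : IsNonlinearSEM P φ L E μZ μζ με θ₁ θ₂ Z ξ ζ' η ζ X ε' Y ε)
    (hΘ₁ : IsStepOneSpace L E Θ₁) (hθ₁ : θ₁ ∈ Θ₁) {φstar : S → Fin l → ℝ}
    (hφstar : φstar = P[fun ω => φ (ξ 0 ω) |
      MeasurableSpace.comap (fun ω => (X 0 ω, Z 0 ω)) inferInstance]) :
    IsRegression (MeasurableSpace.comap (fun ω => (X 0 ω, Z 0 ω)) inferInstance) P (Z 0) φstar
      (Y 0) ⟨θ₂.toStepTwoCore, θ₂.Psi + θ₂.B * crossCov P (fun ω => φ (ξ 0 ω) - φstar ω)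
          (fun ω => φ (ξ 0 ω) - φstar ω) * θ₂.Bᵀ⟩ := by
  have := hsem.covariate_law.1
  have := hsem.residual_outcome.isProbabilityMeasure
  have := hsem.error_outcome.isProbabilityMeasure
  have := hΘ₁.isProbabilityMeasure_law (μZ := μZ) hθ₁
  have hB := hΘ₁.isUnit θ₁ hθ₁
  obtain ⟨hζ, hζ', hε, hε'⟩ := hsem.measurable_residual 0
  have hZ := hsem.measurable_covariate 0
  let T : S → (Fin r → ℝ) × (Fin q → ℝ) × (Fin h → ℝ) := fun ω => (Z 0 ω, ζ' 0 ω, ε' 0 ω)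
  have hT : Measurable T := hZ.prodMk (hζ'.prodMk hε')
  have hlaw : P.map (fun ω => (ζ 0 ω, ε 0 ω, T ω)) = μζ.prod (με.prod (θ₁.law L E μZ)) :=
    hsem.map_exogenous hΘ₁ hθ₁ 0
  have hlawζ : P.map (ζ 0) = μζ := by
    have h1 := congrArg (fun ν => ν.map Prod.fst) hlaw
    simp only [Measure.map_fst_prod, measure_univ, one_smul] at h1
    rwa [Measure.map_map measurable_fst (hζ.prodMk (hε.prodMk hT))] at h1
  have hlawεT : P.map (fun ω => (ε 0 ω, T ω)) = με.prod (θ₁.law L E μZ) := by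
    have h1 := congrArg (fun ν => ν.map Prod.snd) hlaw
    simp only [Measure.map_snd_prod, measure_univ, one_smul] at h1
    rwa [Measure.map_map measurable_snd (hζ.prodMk (hε.prodMk hT))] at h1
  have hlawε : P.map (ε 0) = με := by
    have h1 := congrArg (fun ν => ν.map Prod.fst) hlawεT
    simp only [Measure.map_fst_prod, measure_univ, one_smul] at h1
    rwa [Measure.map_map measurable_fst (hε.prodMk hT)] at h1
  have hlawT : P.map T = θ₁.law L E μZ := hsem.map_stepOne hΘ₁ hθ₁ 0
  have hindζ : IndepFun (ζ 0) (fun ω => (ε 0 ω, T ω)) P := by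
    rw [indepFun_iff_map_prod_eq_prod_map_map hζ.aemeasurable (hε.prodMk hT).aemeasurable, hlaw,
      hlawζ, hlawεT]
  have hindε : IndepFun (ε 0) T P := by
    rw [indepFun_iff_map_prod_eq_prod_map_map hε.aemeasurable hT.aemeasurable, hlawεT, hlawε,
      hlawT]
  have hindζT : IndepFun (ζ 0) T P := hindζ.comp measurable_id measurable_snd
  have hindζε : IndepFun (ζ 0) (ε 0) P := hindζ.comp measurable_id measurable_fst
  -- measurability with respect to the exogenous variables
  have hobs : (fun ω => (X 0 ω, Z 0 ω)) = fun ω => (θ₁.obs (T ω)).swap := by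
    funext ω
    rw [hsem.obs_eq hB]
    rfl
  have hswap : Measurable fun w => (θ₁.obs w).swap :=
    measurable_swap.comp θ₁.continuous_obs.measurable
  have hleT : MeasurableSpace.comap (fun ω => (X 0 ω, Z 0 ω)) inferInstance ≤
      MeasurableSpace.comap T inferInstance := by
    rw [hobs]
    exact (hswap.comp (comap_measurable T)).comap_le
  have hle := hleT.trans hT.comap_le
  have hfm : ∀ j, Measurable[MeasurableSpace.comap T inferInstance] fun ω => φ (ξ 0 ω) j := by
    intro j
    simp_rw [hsem.latent_eq hB]
    exact (measurable_pi_apply j).comp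
      ((hsem.measurable_phi.comp θ₁.continuous_latent.measurable).comp (comap_measurable T))
  have hζ0 := hsem.residual_outcome.integral_apply_eq_zero hζ hlawζ
  have hε0 := hsem.error_outcome.integral_apply_eq_zero hε hlawε
  have hZlaw : P.map (Z 0) = μZ := by
    have := (hΘ₁.latent_residual θ₁ hθ₁).isProbabilityMeasure
    have := (hΘ₁.error_residual θ₁ hθ₁).isProbabilityMeasure
    have h1 := congrArg (fun ν => ν.map Prod.fst) hlawT
    simp only [StepOneParam.law, Measure.map_fst_prod, measure_univ, one_smul] at h1
    rwa [Measure.map_map measurable_fst hT] at h1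
  subst hφstar
  refine isRegression_condExp hle ?_ (memLp_of_map_eq hsem.covariate_law.2 hZ hZlaw)
    (hsem.finite_variance 0) (memLp_of_map_eq hsem.residual_outcome.memLp hζ hlawζ)
    (memLp_of_map_eq hsem.error_outcome.memLp hε hlawε)
    (fun ω => by rw [hsem.measurement_outcome, hsem.structural_outcome]) ?_ ?_ ?_ ?_ ?_ ?_ ?_
  · exact (measurable_snd.comp (comap_measurable fun ω => (X 0 ω, Z 0 ω))).stronglyMeasurable
  · intro g hg j
    exact integral_mul_eq_zero_of_indepFun hindζT hζ hT (measurable_pi_apply j) (hζ0 j)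
      (hg.measurable.mono hleT le_rfl)
  · intro g hg j
    exact integral_mul_eq_zero_of_indepFun hindε hε hT (measurable_pi_apply j) (hε0 j)
      (hg.measurable.mono hleT le_rfl)
  · intro i j
    exact integral_mul_eq_zero_of_indepFun hindζT hζ hT (measurable_pi_apply i) (hζ0 i) (hfm j)
  · intro i j
    exact integral_mul_eq_zero_of_indepFun hindε hε hT (measurable_pi_apply i) (hε0 i) (hfm j)
  · intro i j
    exact integral_mul_eq_zero_of_indepFun hindζε hζ hε (measurable_pi_apply i) (hζ0 i)
      ((measurable_pi_apply j).comp (comap_measurable (ε 0)))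
  · ext i j
    exact hsem.residual_outcome.secondMoment_apply hζ hlawζ i j
  · ext i j
    exact hsem.error_outcome.secondMoment_apply hε hlawε i j

end PopulationModel

/-! ### Step-one consistency and convergence of the step-two moments -/

section Estimation

variable {p q r l h m : ℕ} {S : Type*} [MeasurableSpace S] {P : Measure S}
  {φ : (Fin q → ℝ) → Fin l → ℝ}
  {L : Matrix (Fin q) (Fin q) ℝ → Measure (Fin q → ℝ)}
  {E : Matrix (Fin h) (Fin h) ℝ → Measure (Fin h → ℝ)} {μZ : Measure (Fin r → ℝ)}
  {μζ : Measure (Fin p → ℝ)} {με : Measure (Fin m → ℝ)} {Θ₁ : Set (StepOneParam q r h)}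
  {θ₁ : StepOneParam q r h} {θ₂ : StepTwoParam p r l m} {Z : ℕ → S → Fin r → ℝ}
  {ξ ζ' : ℕ → S → Fin q → ℝ} {η ζ : ℕ → S → Fin p → ℝ} {X ε' : ℕ → S → Fin h → ℝ}
  {Y ε : ℕ → S → Fin m → ℝ} {dens : StepOneParam q r h → (Fin r → ℝ) × (Fin h → ℝ) → ℝ≥0}
  {pred : StepOneParam q r h → (Fin r → ℝ) × (Fin h → ℝ) → Fin l → ℝ} {φstar : S → Fin l → ℝ}

/-- The step-one estimator is consistent. -/
theorem IsNonlinearSEM.tendsto_stepOne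
    (hsem : IsNonlinearSEM P φ L E μZ μζ με θ₁ θ₂ Z ξ ζ' η ζ X ε' Y ε)
    (hΘ₁ : IsStepOneSpace L E Θ₁) (hθ₁ : θ₁ ∈ Θ₁)
    (hdens : IsConditionalDensity L E μZ Θ₁ dens) (hreg : IsStepOneRegular L E μZ Θ₁ θ₁ dens pred)
    (hid : ∀ θ ∈ Θ₁, θ.obsLaw L E μZ = θ₁.obsLaw L E μZ → θ = θ₁) :
    ∀ᵐ ω ∂P, ∀ e : ℕ → StepOneParam q r h,
      (∀ᶠ n in atTop, IsStepOneFit Θ₁ dens n (fun i => (Z i ω, X i ω)) (e n)) →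
        Tendsto e atTop (𝓝 θ₁) := by
  have := hsem.covariate_law.1
  have hprob : ∀ θ ∈ Θ₁, IsProbabilityMeasure (θ.obsLaw L E μZ) := fun θ hθ => by
    have := hΘ₁.isProbabilityMeasure_law (μZ := μZ) hθ
    exact Measure.isProbabilityMeasure_map θ.continuous_obs.measurable.aemeasurable
  obtain ⟨G, hG, hGle⟩ := hreg.dominated_dens
  have hcont := hreg.continuous_dens
  have hV := hsem.isIID_stepOne hΘ₁ hθ₁
  have heq := hdens.obsLaw_eq
  rw [heq θ₁ hθ₁] at hG hGle hcont hV
  exact hV.tendsto_of_maximises_likelihood hΘ₁.isCompact hθ₁ hdens.measurable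
    (fun θ hθ => heq θ hθ ▸ hprob θ hθ)
    (fun θ hθ hlaw => hid θ hθ (by rw [heq θ hθ, heq θ₁ hθ₁, hlaw])) hcont hG hGle

theorem abs_obsVec_le (z : Fin r → ℝ) (f : Fin l → ℝ) (y : Fin m → ℝ) (c : ObsIndex r l m) :
    |obsVec z f y c| ≤ 1 + ‖z‖ + ‖f‖ + ‖y‖ := by
  have hz := norm_nonneg z
  have hf := norm_nonneg f
  have hy := norm_nonneg y
  rcases c with c | c | c | c
  · simp only [obsVec, Sum.elim_inl, abs_one]
    linarith
  · have := norm_le_pi_norm z c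
    simp only [obsVec, Sum.elim_inl, Sum.elim_inr, ← Real.norm_eq_abs]
    linarith
  · have := norm_le_pi_norm f c
    simp only [obsVec, Sum.elim_inl, Sum.elim_inr, ← Real.norm_eq_abs]
    linarith
  · have := norm_le_pi_norm y c
    simp only [obsVec, Sum.elim_inr, ← Real.norm_eq_abs]
    linarith

theorem continuous_obsVec (z : Fin r → ℝ) (y : Fin m → ℝ) (c : ObsIndex r l m) :
    Continuous fun f : Fin l → ℝ => obsVec z f y c := by
  rcases c with c | c | c | c
  · exact continuous_const
  · exact continuous_const
  · exact continuous_apply c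
  · exact continuous_const

theorem measurable_obsVec (c : ObsIndex r l m) :
    Measurable fun w : (Fin r → ℝ) × (Fin l → ℝ) × (Fin m → ℝ) => obsVec w.1 w.2.1 w.2.2 c := by
  rcases c with c | c | c | c
  · exact measurable_const
  · exact (measurable_pi_apply c).comp measurable_fst
  · exact (measurable_pi_apply c).comp (measurable_fst.comp measurable_snd)
  · exact (measurable_pi_apply c).comp (measurable_snd.comp measurable_snd)

variable [IsProbabilityMeasure P]

/-- At the true parameter, the modelled conditional mean is the conditional mean of a subject. -/
theorem IsNonlinearSEM.pred_ae_eq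
    (hsem : IsNonlinearSEM P φ L E μZ μζ με θ₁ θ₂ Z ξ ζ' η ζ X ε' Y ε)
    (hΘ₁ : IsStepOneSpace L E Θ₁) (hθ₁ : θ₁ ∈ Θ₁) (hpred : IsConditionalMean L E μZ φ Θ₁ pred)
    (hφstar : φstar = P[fun ω => φ (ξ 0 ω) |
      MeasurableSpace.comap (fun ω => (X 0 ω, Z 0 ω)) inferInstance]) :
    (fun ω => pred θ₁ (Z 0 ω, X 0 ω)) =ᵐ[P] φstar := by
  have hB := hΘ₁.isUnit θ₁ hθ₁
  obtain ⟨hζ, hζ', hε, hε'⟩ := hsem.measurable_residual 0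
  have hT : Measurable fun ω => (Z 0 ω, ζ' 0 ω, ε' 0 ω) :=
    (hsem.measurable_covariate 0).prodMk (hζ'.prodMk hε')
  have hlaw := hsem.map_stepOne hΘ₁ hθ₁ 0
  have hInt := hpred.integrable θ₁ hθ₁
  have hae := hpred.ae_eq_condExp θ₁ hθ₁
  -- `pred` is defined on the model's space of exogenous variables; viewing its law as that of `(Z
  -- 0, ζ' 0, ε' 0)` transports the conditional mean to `P`.
  rw [← hlaw] at hInt hae
  have h1 := condExp_comp_ae_eq hT θ₁.continuous_obs.measurable hInt
  have h2 := ae_of_ae_map hT.aemeasurable hae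
  have hcomap : MeasurableSpace.comap (fun ω => (X 0 ω, Z 0 ω)) inferInstance =
      MeasurableSpace.comap (fun ω => (Z 0 ω, X 0 ω)) inferInstance := le_antisymm
    (measurable_swap.comp (comap_measurable fun ω => (Z 0 ω, X 0 ω))).comap_le
    (measurable_swap.comp (comap_measurable fun ω => (X 0 ω, Z 0 ω))).comap_le
  simp only [hsem.obs_eq hB, ← hsem.latent_eq hB] at h1 h2
  rw [hφstar, hcomap]
  exact EventuallyEq.trans h2 h1

/-- The second empirical moments of the step-two observations converge if the conditional means
are computed with a consistent step-one estimator. -/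
theorem IsNonlinearSEM.tendsto_sampleMoments
    (hsem : IsNonlinearSEM P φ L E μZ μζ με θ₁ θ₂ Z ξ ζ' η ζ X ε' Y ε)
    (hΘ₁ : IsStepOneSpace L E Θ₁) (hθ₁ : θ₁ ∈ Θ₁) (hpred : IsConditionalMean L E μZ φ Θ₁ pred)
    (hreg : IsStepOneRegular L E μZ Θ₁ θ₁ dens pred)
    (hφstar : φstar = P[fun ω => φ (ξ 0 ω) |
      MeasurableSpace.comap (fun ω => (X 0 ω, Z 0 ω)) inferInstance]) :
    ∀ᵐ ω ∂P, ∀ e : ℕ → StepOneParam q r h, (∀ᶠ n in atTop, e n ∈ Θ₁) →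
      Tendsto e atTop (𝓝 θ₁) →
      Tendsto (fun n => sampleMoments n fun i =>
          obsVec (Z i ω) (pred (e n) (Z i ω, X i ω)) (Y i ω)) atTop
        (𝓝 (secondMoment P fun ω => obsVec (Z 0 ω) (φstar ω) (Y 0 ω))) := by
  have hregr := hsem.isRegression hΘ₁ hθ₁ hφstar
  have hV := hsem.isIID_stepTwo (hΘ₁.isUnit θ₁ hθ₁)
  set μ := P.map fun ω => ((Z 0 ω, X 0 ω), Y 0 ω) with hμ
  have hV0 := hV.measurable 0
  have hfst : μ.map Prod.fst = θ₁.obsLaw L E μZ := by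
    rw [hμ, Measure.map_map measurable_fst hV0, ← (hsem.isIID_stepOne hΘ₁ hθ₁).map_eq 0]
    rfl
  obtain ⟨U, hU, H, hH, hHle⟩ := hreg.dominated_pred
  have hcont := hreg.continuous_pred
  rw [← hfst] at hH hHle hcont
  replace hHle := ae_of_ae_map measurable_fst.aemeasurable hHle
  replace hcont := ae_of_ae_map measurable_fst.aemeasurable hcont
  have hθ₁U : θ₁ ∈ U ∩ Θ₁ := ⟨mem_of_mem_nhds hU, hθ₁⟩
  -- the dominating function
  let b : ((Fin r → ℝ) × (Fin h → ℝ)) × (Fin m → ℝ) → ℝ := fun w =>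
    1 + ‖w.1.1‖ + H w.1 + ‖w.2‖
  have hb : MemLp b 2 μ := by
    have hZ2 : MemLp (fun w : ((Fin r → ℝ) × (Fin h → ℝ)) × (Fin m → ℝ) => w.1.1) 2 μ :=
      (memLp_map_measure_iff (by fun_prop) hV0.aemeasurable).2 hregr.memLp_covariate
    have hY2 : MemLp (fun w : ((Fin r → ℝ) × (Fin h → ℝ)) × (Fin m → ℝ) => w.2) 2 μ :=
      (memLp_map_measure_iff (by fun_prop) hV0.aemeasurable).2 hregr.memLp_outcome
    have hH2 : MemLp (fun w : ((Fin r → ℝ) × (Fin h → ℝ)) × (Fin m → ℝ) => H w.1) 2 μ :=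
      (memLp_map_measure_iff hH.1 measurable_fst.aemeasurable).1 hH
    have : IsProbabilityMeasure μ := Measure.isProbabilityMeasure_map hV0.aemeasurable
    exact (((memLp_const (1 : ℝ)).add hZ2.norm).add hH2).add hY2.norm
  -- Entries of the moment matrix as functions of the step-one parameter. On `U ∩ Θ₁` the
  -- predictions are measurable, almost surely continuous in the parameter, and dominated; `b ^ 2`
  -- is an integrable bound.
  let f : ObsIndex r l m → ObsIndex r l m → ↥(U ∩ Θ₁) →
      ((Fin r → ℝ) × (Fin h → ℝ)) × (Fin m → ℝ) → ℝ := fun c d θ w =>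
    obsVec w.1.1 (pred θ w.1) w.2 c * obsVec w.1.1 (pred θ w.1) w.2 d
  have hf : ∀ c d θ, Measurable (f c d θ) := fun c d θ => by
    have hw : Measurable fun w : ((Fin r → ℝ) × (Fin h → ℝ)) × (Fin m → ℝ) =>
        (w.1.1, pred θ w.1, w.2) :=
      (measurable_fst.comp measurable_fst).prodMk
        (((hpred.measurable θ θ.2.2).comp measurable_fst).prodMk measurable_snd)
    exact ((measurable_obsVec c).comp hw).mul ((measurable_obsVec d).comp hw)
  have hfcont : ∀ c d, ∀ᵐ w ∂μ, Continuous fun θ => f c d θ w := fun c d => by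
    filter_upwards [hcont] with w hw
    have h1 : Continuous fun θ : ↥(U ∩ Θ₁) => pred θ w.1 :=
      (hw.mono Set.inter_subset_right).comp_continuous continuous_subtype_val fun θ => θ.2
    exact ((continuous_obsVec _ _ c).comp h1).mul ((continuous_obsVec _ _ d).comp h1)
  have hfle : ∀ c d, ∀ᵐ w ∂μ, ∀ θ, |f c d θ w| ≤ b w ^ 2 := fun c d => by
    filter_upwards [hHle] with w hw θ
    have h1 : ∀ c, |obsVec w.1.1 (pred θ w.1) w.2 c| ≤ b w := fun c =>
      (abs_obsVec_le _ _ _ c).trans (by have := hw θ θ.2; simp only [b]; linarith)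
    rw [abs_mul, sq]
    exact mul_le_mul (h1 c) (h1 d) (abs_nonneg _) ((abs_nonneg _).trans (h1 c))
  have hlim : ∀ c d, ∫ w, f c d ⟨θ₁, hθ₁U⟩ w ∂μ =
      ∫ ω, obsVec (Z 0 ω) (φstar ω) (Y 0 ω) c * obsVec (Z 0 ω) (φstar ω) (Y 0 ω) d ∂P :=
    fun c d => by
      rw [hμ, integral_map hV0.aemeasurable (hf c d _).aestronglyMeasurable]
      refine integral_congr_ae ?_
      filter_upwards [hsem.pred_ae_eq hΘ₁ hθ₁ hpred hφstar] with ω hω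
      simp only [f, hω]
  have hall : ∀ᵐ ω ∂P, ∀ c d, ∀ e : ℕ → ↥(U ∩ Θ₁), Tendsto e atTop (𝓝 ⟨θ₁, hθ₁U⟩) →
      Tendsto (fun n : ℕ => (∑ i ∈ Finset.range n, f c d (e n) ((Z i ω, X i ω), Y i ω)) / n) atTop
        (𝓝 (∫ w, f c d ⟨θ₁, hθ₁U⟩ w ∂μ)) := by
    rw [ae_all_iff]
    intro c
    rw [ae_all_iff]
    exact fun d => hV.tendsto_average (hf c d) (hfcont c d) hb.integrable_sq (hfle c d) _
  filter_upwards [hall] with ω hω e heΘ he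
  classical
  -- The finitely many terms outside `U ∩ Θ₁` are replaced by `θ₁`, which does not affect the limit.
  let e' : ℕ → ↥(U ∩ Θ₁) := fun n => if hn : e n ∈ U ∩ Θ₁ then ⟨e n, hn⟩ else ⟨θ₁, hθ₁U⟩
  have hmem : ∀ᶠ n in atTop, e n ∈ U ∩ Θ₁ := (he.eventually_mem hU).and heΘ
  have he'eq : ∀ᶠ n in atTop, (e' n : StepOneParam q r h) = e n :=
    hmem.mono fun n hn => by simp only [e', dif_pos hn]
  have he' : Tendsto e' atTop (𝓝 ⟨θ₁, hθ₁U⟩) :=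
    tendsto_subtype_rng.2 (he.congr' (he'eq.mono fun n hn => hn.symm))
  refine tendsto_pi_nhds.2 fun c => tendsto_pi_nhds.2 fun d => ?_
  have h1 := hω c d e' he'
  rw [hlim] at h1
  refine h1.congr' ?_
  filter_upwards [he'eq] with n hn
  simp only [f, hn, sampleMoments, Matrix.of_apply]

end Estimation

end TwoStageSEM

end

/-! ### The consistency theorem -/

open TwoStageSEM in
theorem theorem1 {p q r l h m : ℕ} {S : Type*} [MeasurableSpace S]
    (P : Measure S) [IsProbabilityMeasure P]
    (φ : (Fin q → ℝ) → Fin l → ℝ)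
    (L : Matrix (Fin q) (Fin q) ℝ → Measure (Fin q → ℝ))
    (E : Matrix (Fin h) (Fin h) ℝ → Measure (Fin h → ℝ))
    (μZ : Measure (Fin r → ℝ)) (μζ : Measure (Fin p → ℝ)) (με : Measure (Fin m → ℝ))
    (Θ₁ : Set (StepOneParam q r h)) (C₂ : Set (StepTwoCore p r l m))
    (θ₁ : StepOneParam q r h) (θ₂ : StepTwoParam p r l m)
    (hΘ₁ : IsStepOneSpace L E Θ₁) (hC₂ : IsStepTwoConstraint C₂)
    (hθ₁ : θ₁ ∈ Θ₁) (hθ₂ : θ₂ ∈ stepTwoSpace C₂) (hpos : θ₂.resCov.PosDef)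
    (Z : ℕ → S → Fin r → ℝ) (ξ ζ' : ℕ → S → Fin q → ℝ) (η ζ : ℕ → S → Fin p → ℝ)
    (X ε' : ℕ → S → Fin h → ℝ) (Y ε : ℕ → S → Fin m → ℝ)
    (hsem : IsNonlinearSEM P φ L E μZ μζ με θ₁ θ₂ Z ξ ζ' η ζ X ε' Y ε)
    (dens : StepOneParam q r h → (Fin r → ℝ) × (Fin h → ℝ) → ℝ≥0)
    (pred : StepOneParam q r h → (Fin r → ℝ) × (Fin h → ℝ) → Fin l → ℝ)
    (hdens : IsConditionalDensity L E μZ Θ₁ dens)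
    (hpred : IsConditionalMean L E μZ φ Θ₁ pred)
    (hreg : IsStepOneRegular L E μZ Θ₁ θ₁ dens pred)
    (φstar : S → Fin l → ℝ)
    (hφstar : φstar = P[fun ω => φ (ξ 0 ω) |
      MeasurableSpace.comap (fun ω => (X 0 ω, Z 0 ω)) inferInstance])
    (hid₁ : ∀ θ ∈ Θ₁, θ.obsLaw L E μZ = θ₁.obsLaw L E μZ → θ = θ₁)
    (hid₂ : ∀ θ ∈ stepTwoSpace C₂, ∀ θ' ∈ stepTwoSpace C₂,
      InducesMoments P (Z 0) φstar (Y 0) θ → InducesMoments P (Z 0) φstar (Y 0) θ' → θ = θ')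
    (est₁ : ℕ → S → StepOneParam q r h) (est₂ : ℕ → S → StepTwoParam p r l m)
    (hest₁ : ∀ᵐ ω ∂P, ∀ᶠ n in atTop,
      IsStepOneFit Θ₁ dens n (fun i => (Z i ω, X i ω)) (est₁ n ω))
    (hest₂ : ∀ᵐ ω ∂P, ∀ᶠ n in atTop,
      IsStepTwoFit C₂ n (fun i => Z i ω) (fun i => pred (est₁ n ω) (Z i ω, X i ω))
        (fun i => Y i ω) (est₂ n ω)) :
    ∀ᵐ ω ∂P,
      Tendsto (fun n => est₁ n ω) atTop (𝓝 θ₁) ∧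
      Tendsto (fun n => (est₂ n ω).toStepTwoCore) atTop (𝓝 θ₂.toStepTwoCore) ∧
      Tendsto (fun n => (est₂ n ω).Psi) atTop
        (𝓝 (θ₂.Psi + θ₂.B * crossCov P (fun ω => φ (ξ 0 ω) - φstar ω)
          (fun ω => φ (ξ 0 ω) - φstar ω) * θ₂.Bᵀ)) := by
  have hregr := hsem.isRegression hΘ₁ hθ₁ hφstar
  have hφmem : MemLp (fun ω => φ (ξ 0 ω) - φstar ω) 2 P :=
    (hsem.finite_variance 0).sub hregr.memLp_prediction
  set V := crossCov P (fun ω => φ (ξ 0 ω) - φstar ω) (fun ω => φ (ξ 0 ω) - φstar ω)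
  have hVpos : (θ₂.B * V * θ₂.Bᵀ).PosSemidef := by
    simpa [Matrix.conjTranspose_eq_transpose_of_trivial] using
      (crossCov_self_posSemidef hφmem).mul_mul_conjTranspose_same θ₂.B
  -- The pseudo-true parameter: it is admissible because `Psi` may be any positive semidefinite
  -- matrix, and its residual covariance stays positive definite since only a positive semidefinite
  -- term is added.
  let θ₀ : StepTwoParam p r l m := ⟨θ₂.toStepTwoCore, θ₂.Psi + θ₂.B * V * θ₂.Bᵀ⟩
  have hθ₀ : θ₀ ∈ stepTwoSpace C₂ := ⟨hθ₂.1, hθ₂.2.add hVpos⟩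
  have hpos₀ : θ₀.resCov.PosDef := by
    have h1 : θ₀.resCov = θ₂.resCov + θ₂.Lambda * (θ₂.B * V * θ₂.Bᵀ) * θ₂.Lambdaᵀ := by
      simp only [θ₀, StepTwoParam.resCov, Matrix.mul_add, Matrix.add_mul]
      abel
    rw [h1]
    refine hpos.add_posSemidef ?_
    simpa [Matrix.conjTranspose_eq_transpose_of_trivial] using
      hVpos.mul_mul_conjTranspose_same θ₂.Lambda
  have hdiff : ∀ θ : StepTwoParam p r l m,
      MemLp (fun ω => θ₀.mean (Z 0 ω) (φstar ω) - θ.mean (Z 0 ω) (φstar ω)) 2 P := fun θ =>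
    (hregr.memLp_mean θ₀).sub (hregr.memLp_mean θ)
  filter_upwards [hest₁, hest₂, hsem.tendsto_stepOne hΘ₁ hθ₁ hdens hreg hid₁,
    hsem.tendsto_sampleMoments hΘ₁ hθ₁ hpred hreg hφstar] with ω h₁ h₂ hone hmom
  have hlim₁ := hone (fun n => est₁ n ω) h₁
  refine ⟨hlim₁, ?_⟩
  refine tendsto_of_objective_le (θ₀ := θ₀) hC₂ hpos₀ ?_ ?_ ?_
    (hmom (fun n => est₁ n ω) (h₁.mono fun n hn => hn.1) hlim₁) ?_
  · intro θ
    rw [hregr.residual_secondMoment θ, add_sub_cancel_left]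
    exact secondMoment_posSemidef (hdiff θ)
  · have h0 : secondMoment P
        (fun ω => θ₀.mean (Z 0 ω) (φstar ω) - θ₀.mean (Z 0 ω) (φstar ω)) = 0 := by
      ext i j
      simp [secondMoment]
    exact (hregr.residual_secondMoment θ₀).trans
      ((congrArg (θ₀.resCov + ·) h0).trans (add_zero _))
  · intro θ hθ hmean hcov
    -- Equal residual moments leave `E[d dᵗ] = 0` for the difference `d` of the modelled means. So
    -- `θ` and `θ₀` model the same mean almost surely, both reproduce the moments, and `hid₂`
    -- identifies them.
    rw [hregr.residual_secondMoment θ, add_eq_left] at hmean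
    refine hid₂ θ hθ θ₀ hθ₀ (hregr.inducesMoments ?_ hcov)
      (hregr.inducesMoments EventuallyEq.rfl rfl)
    filter_upwards [ae_eq_zero_of_secondMoment_eq_zero (hdiff θ) hmean] with ω hω
    exact (sub_eq_zero.1 hω).symm
  · filter_upwards [h₂, eventually_gt_atTop 0] with n hn hn0
    exact ⟨hn.1, hn.2.1, hn.objective_le hn0 hθ₀ hpos₀⟩
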